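/- Let $\delta\in(0,1)$. Let $X_1,X_2,\ldots$ be independent identically distributed real random variables with distribution function $F(x)={\sf P}(X_i<x)$, let $\mathrm{lext}(F)=\inf\{x: F(x)>0\}$, and let $N_k=P(U_k)$, $k\ge1$, where $P(t)$, $t\ge0$, is a homogeneous Poisson process with unit intensity and $U_k$ is a nonnegative random variable independent of the process $P$; assume that for each $k$ the random variable $N_k$ is independent of the sequence $X_1,X_2,\ldots$ Suppose that (i) for some $\delta'\in(\delta,1]$ the distribution function $F$ belongs to the domain of min-attraction of the Weibull distribution with shape parameter $\delta'$, that is, $\mathrm{lext}(F)>-\infty$ and, with $A_F(x)=F(\mathrm{lext}(F)-x^{-1})$, $\lim_{y\to-\infty}A_F(yx)/A_F(y)=x^{-\delta'}$ for every $x>0$; (ii) there is a sequence of positive numbers $d_k\to\infty$ such that $U_k/d_k\Longrightarrow S_{\delta',1}^{-\delta'}K_{\delta/\delta'}^{\delta'/\delta}$ as $k\to\infty$, where $S_{\delta',1}$ and $K_{\delta/\delta'}$ are independent, $S_{\delta',1}$ has the one-sided strictly stable law with characteristic function $\exp\{-|t|^{\delta'}\exp\{-\frac12 i\pi\delta'\,\mathrm{sign}\,t\}\}$,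 and $K_\rho$, $\rho\in(0,1)$, has the density $\frac{\sin(\pi\rho)}{\pi\rho[x^2+2x\cos(\pi\rho)+1]}$, $x>0$. Then there exist numbers $a_k\in\mathbb{R}$ and $b_k>0$ such that $$\frac{1}{b_k}\Big(\min_{1\le j\le N_k}X_j-a_k\Big)\Longrightarrow M_\delta\quad(k\to\infty),$$ where $M_\delta$ has the Mittag-Leffler law, i.e. the law of a nonnegative random variable with Laplace transform ${\sf E}e^{-sM_\delta}=1/(1+s^\delta)$, $s\ge0$ (the minimum over an empty sample may be given any constant value). Moreover, one can take $a_k=\mathrm{lext}(F)$ for all $k$ and $b_k=\sup\{x: F(x)\le d_k^{-1}\}-\mathrm{lext}(F)$, which is finite and positive, for every $k$ with $d_k>1$ (hence for all but finitely many $k$). -/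

import Mathlib

open MeasureTheory ProbabilityTheory Filter Set
open scoped NNReal ENNReal Topology

noncomputable section

/-- `Q` is a homogeneous Poisson process with unit intensity on `(Ω, P)`: it starts at zero, its
paths are nondecreasing, right-continuous and integer-valued, its increments over disjoint
intervals are independent, and the increment over `(s, t]` has the Poisson law with mean `t - s`.
(The subtraction of natural numbers below is exact, since the paths are nondecreasing.) -/
structure IsUnitPoissonProcess {Ω : Type*} [MeasurableSpace Ω] (Q : ℝ≥0 → Ω → ℕ)
    (P : Measure Ω) : Prop where
  measurable : ∀ t, Measurable (Q t)
  zero : ∀ ω, Q 0 ω = 0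
  mono : ∀ ω, Monotone (fun t => Q t ω)
  rightCont : ∀ ω t, ContinuousWithinAt (fun s => Q s ω) (Ici t) t
  indepIncrements : HasIndepIncrements Q P
  increment_law : ∀ s t, s ≤ t → P.map (fun ω => Q t ω - Q s ω) = poissonMeasure (t - s)

/-- The probability measure `ν` on `ℝ` is the strictly stable law `G_{α,θ}`, i.e. its
characteristic function is `exp(-|t|^α exp(-iπθα sign(t)/2))`. -/
structure IsStrictlyStable (α θ : ℝ) (ν : Measure ℝ) : Prop where
  isProbabilityMeasure : IsProbabilityMeasure ν
  charFun_eq : ∀ t : ℝ, charFun ν t =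
    Complex.exp (-((|t| ^ α : ℝ) : ℂ) *
      Complex.exp (-(1 / 2) * Complex.I * ((Real.pi * θ * α * SignType.sign t : ℝ) : ℂ)))

/-- The density of `K_ρ`: `sin(πρ) / (πρ (x² + 2x cos(πρ) + 1))` for `x > 0`. -/
def kDensity (ρ x : ℝ) : ℝ :=
  if 0 < x then
    Real.sin (Real.pi * ρ) / (Real.pi * ρ * (x ^ 2 + 2 * x * Real.cos (Real.pi * ρ) + 1))
  else 0

/-- The law of `K_ρ`. -/
def kMeasure (ρ : ℝ) : Measure ℝ :=
  volume.withDensity (fun x => ENNReal.ofReal (kDensity ρ x))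

/-- The probability measure `ν` on `ℝ` is the (standard) Mittag-Leffler law with parameter `δ`:
the law of a nonnegative random variable with Laplace transform `1 / (1 + s^δ)`, `s ≥ 0`. -/
structure IsMittagLeffler (δ : ℝ) (ν : Measure ℝ) : Prop where
  isProbabilityMeasure : IsProbabilityMeasure ν
  nonneg : ∀ᵐ x ∂ν, 0 ≤ x
  laplace : ∀ s : ℝ, 0 ≤ s → ∫ x, Real.exp (-s * x) ∂ν = 1 / (1 + s ^ δ)

/-- The left endpoint `lext(F) = inf {x : F(x) > 0}` of a distribution function
(meaningful when the set is bounded below). -/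
def lext (F : ℝ → ℝ) : ℝ := sInf {x | 0 < F x}

/-- The distribution function `F` belongs to the domain of min-attraction of the Weibull law with
shape parameter `γ`: `lext(F) > -∞` and `A_F(x) = F(lext(F) - 1/x)` satisfies
`A_F(yx) / A_F(y) → x^{-γ}` as `y → -∞` for every `x > 0`. -/
structure MinDomainWeibull (F : ℝ → ℝ) (γ : ℝ) : Prop where
  lext_finite : BddBelow {x | 0 < F x}
  regular : ∀ x : ℝ, 0 < x →
    Tendsto (fun y : ℝ => F (lext F - (y * x)⁻¹) / F (lext F - y⁻¹)) atBot (𝓝 (x ^ (-γ)))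

/-- The minimum of the first `n` terms of the sequence `x`; the minimum of an empty sample is
taken to be `c`. -/
def sampleMin (c : ℝ) (x : ℕ → ℝ) (n : ℕ) : ℝ :=
  if h : (Finset.range n).Nonempty then (Finset.range n).inf' h x else c

end

/-! Write 𝔼 for expectation. A unit Poisson process read at an independent random time `U` gives a
count with generating function 𝔼 z^N = 𝔼 exp(-(1-z)U). Conditioning on the sample size, the tail of
the minimum at y is, up to P(N_k = 0) → 0, equal to 𝔼 (1-F(y))^{N_k} = 𝔼 exp(-d_k F(y) · U_k/d_k).
At y = lext F + b_k x with x > 0, regular variation gives d_k F(y) → x^δ'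
(`MinDomainWeibull.tendsto_mul`), so the tail tends to 𝔼 exp(-x^δ' W) with W = S^(-δ') K^(δ'/δ). For
E standard exponential and independent of (S, K), this limit is P(E^(1/δ') S K^(-1/δ) ≥ x).

It remains to see that this product has the Mittag-Leffler law. The tool is the Stieltjes transform
𝔼 (1 + u K_ρ^(-1/ρ))⁻¹ = (1 + u^ρ)⁻¹ for u = e^v in the closed right half-plane, obtained by contour
integration (`integral_logKDensity_mul`). At imaginary u it shows that E^(1/α) S and E K_α^(-1/α)
have the same characteristic function when α < 1. At positive u it gives 1/(1+s^α) as the Laplace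
transform of the second variable, hence of the first. This leads from the characteristic function of
S to a Laplace transform without analytic continuation, and also yields S > 0. The case α = 1 is
degenerate, S = 1. Conditioning on K and using the Stieltjes transform with ρ = δ/δ' and u = s^δ'
turns 𝔼 1/(1 + s^δ' K^(-δ'/δ)) into 1/(1 + s^δ). -/

/-! ### The law of K_ρ and its logarithmic coordinates -/

lemma sin_pi_mul_pos {ρ : ℝ} (h0 : 0 < ρ) (h1 : ρ < 1) : 0 < Real.sin (Real.pi * ρ) := by
  apply Real.sin_pos_of_pos_of_lt_pi
  · positivity
  · nlinarith [Real.pi_pos]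

lemma kDensity_denom_pos {ρ : ℝ} (h0 : 0 < ρ) (h1 : ρ < 1) (x : ℝ) :
    0 < x ^ 2 + 2 * x * Real.cos (Real.pi * ρ) + 1 := by
  have h := sin_pi_mul_pos h0 h1
  have h2 := Real.sin_sq_add_cos_sq (Real.pi * ρ)
  have : x ^ 2 + 2 * x * Real.cos (Real.pi * ρ) + 1 =
      (x + Real.cos (Real.pi * ρ)) ^ 2 + Real.sin (Real.pi * ρ) ^ 2 := by
    linear_combination (-1 : ℝ) * h2
  rw [this]
  positivity

lemma kDensity_nonneg {ρ : ℝ} (h0 : 0 < ρ) (h1 : ρ < 1) (x : ℝ) : 0 ≤ kDensity ρ x := by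
  unfold kDensity
  split_ifs
  · have := sin_pi_mul_pos h0 h1
    have := kDensity_denom_pos h0 h1 x
    positivity
  · exact le_rfl

lemma measurable_kDensity (ρ : ℝ) : Measurable (kDensity ρ) := by
  unfold kDensity
  refine Measurable.ite measurableSet_Ioi ?_ measurable_const
  fun_prop

/-- A primitive of the density of `K_ρ`. -/
lemma hasDerivAt_arctan_kDensity {ρ : ℝ} (h0 : 0 < ρ) (h1 : ρ < 1) {x : ℝ} (hx : 0 < x) :
    HasDerivAt (fun x => (Real.pi * ρ)⁻¹ *
      Real.arctan ((x + Real.cos (Real.pi * ρ)) / Real.sin (Real.pi * ρ))) (kDensity ρ x) x := by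
  have hs := sin_pi_mul_pos h0 h1
  have hd := kDensity_denom_pos h0 h1 x
  have h2 := Real.sin_sq_add_cos_sq (Real.pi * ρ)
  have := (((hasDerivAt_id x).add_const (Real.cos (Real.pi * ρ))).div_const
    (Real.sin (Real.pi * ρ))).arctan.const_mul (Real.pi * ρ)⁻¹
  convert! this using 1
  have e : 1 + ((x + Real.cos (Real.pi * ρ)) / Real.sin (Real.pi * ρ)) ^ 2 =
      (x ^ 2 + 2 * x * Real.cos (Real.pi * ρ) + 1) / Real.sin (Real.pi * ρ) ^ 2 := by
    field_simp
    linear_combination h2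
  simp only [id, e, kDensity, if_pos hx]
  field_simp

lemma tendsto_arctan_kDensity {ρ : ℝ} (h0 : 0 < ρ) (h1 : ρ < 1) :
    Tendsto (fun x => (Real.pi * ρ)⁻¹ *
      Real.arctan ((x + Real.cos (Real.pi * ρ)) / Real.sin (Real.pi * ρ))) atTop
      (𝓝 ((Real.pi * ρ)⁻¹ * (Real.pi / 2))) := by
  have hs := sin_pi_mul_pos h0 h1
  refine Tendsto.const_mul _ ?_
  refine (Real.tendsto_arctan_atTop.mono_right nhdsWithin_le_nhds).comp ?_
  exact (tendsto_atTop_add_const_right _ _ tendsto_id).atTop_div_const hs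

lemma integrableOn_kDensity {ρ : ℝ} (h0 : 0 < ρ) (h1 : ρ < 1) :
    IntegrableOn (kDensity ρ) (Ioi 0) := by
  refine integrableOn_Ioi_deriv_of_nonneg ?_
    (fun x hx => hasDerivAt_arctan_kDensity h0 h1 hx) (fun x _ => kDensity_nonneg h0 h1 x)
    (tendsto_arctan_kDensity h0 h1)
  have hs := sin_pi_mul_pos h0 h1
  exact (by fun_prop : Continuous _).continuousWithinAt

lemma integral_kDensity {ρ : ℝ} (h0 : 0 < ρ) (h1 : ρ < 1) :
    ∫ x in Ioi 0, kDensity ρ x = 1 := by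
  have hs := sin_pi_mul_pos h0 h1
  rw [integral_Ioi_of_hasDerivAt_of_nonneg ?_
    (fun x hx => hasDerivAt_arctan_kDensity h0 h1 hx) (fun x _ => kDensity_nonneg h0 h1 x)
    (tendsto_arctan_kDensity h0 h1)]
  -- The boundary term at zero is arctan(cot(πρ)) = π/2 - πρ, which leaves exactly the normalisation
  -- πρ.
  · have : (0 + Real.cos (Real.pi * ρ)) / Real.sin (Real.pi * ρ) =
        Real.tan (Real.pi / 2 - Real.pi * ρ) := by
      rw [Real.tan_eq_sin_div_cos, Real.sin_pi_div_two_sub, Real.cos_pi_div_two_sub, zero_add]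
    rw [this, Real.arctan_tan]
    · field_simp
      ring
    · nlinarith [Real.pi_pos]
    · nlinarith [Real.pi_pos]
  · exact (by fun_prop : Continuous _).continuousWithinAt

lemma ofReal_kDensity_eq_indicator (ρ : ℝ) :
    (fun x => ENNReal.ofReal (kDensity ρ x)) =
      (Ioi (0 : ℝ)).indicator (fun x => ENNReal.ofReal (kDensity ρ x)) := by
  ext x
  by_cases hx : 0 < x
  · simp [hx]
  · simp [hx, kDensity]

lemma kMeasure_eq_restrict (ρ : ℝ) :
    kMeasure ρ = (volume.restrict (Ioi (0 : ℝ))).withDensity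
      (fun x => ENNReal.ofReal (kDensity ρ x)) := by
  rw [kMeasure, ofReal_kDensity_eq_indicator, withDensity_indicator measurableSet_Ioi]
  rw [← ofReal_kDensity_eq_indicator]

lemma isProbabilityMeasure_kMeasure {ρ : ℝ} (h0 : 0 < ρ) (h1 : ρ < 1) :
    IsProbabilityMeasure (kMeasure ρ) := by
  constructor
  rw [kMeasure_eq_restrict, withDensity_apply _ MeasurableSet.univ, Measure.restrict_univ,
    ← ofReal_integral_eq_lintegral_ofReal (integrableOn_kDensity h0 h1)
      (ae_of_all _ (kDensity_nonneg h0 h1)), integral_kDensity h0 h1, ENNReal.ofReal_one]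

lemma kMeasure_ae_pos (ρ : ℝ) : ∀ᵐ x ∂kMeasure ρ, 0 < x := by
  rw [kMeasure_eq_restrict]
  exact (withDensity_absolutelyContinuous _ _).ae_le (ae_restrict_mem measurableSet_Ioi)

/-- The density of `ρ⁻¹ * log K_ρ`. -/
noncomputable def logKDensity (ρ x : ℝ) : ℝ := ρ * Real.exp (ρ * x) * kDensity ρ (Real.exp (ρ * x))

lemma image_exp_mul {ρ : ℝ} (h0 : 0 < ρ) : (fun x : ℝ => Real.exp (ρ * x)) '' univ = Ioi 0 := by
  ext y
  simp only [image_univ, mem_range, mem_Ioi]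
  constructor
  · rintro ⟨x, rfl⟩
    exact Real.exp_pos _
  · intro hy
    exact ⟨Real.log y / ρ, by rw [mul_div_cancel₀ _ h0.ne', Real.exp_log hy]⟩

lemma hasDerivWithinAt_exp_mul (ρ x : ℝ) :
    HasDerivWithinAt (fun x : ℝ => Real.exp (ρ * x)) (ρ * Real.exp (ρ * x)) univ x := by
  have := ((hasDerivAt_id x).const_mul ρ).exp.hasDerivWithinAt (s := univ)
  simpa [mul_comm] using this

lemma injOn_exp_mul {ρ : ℝ} (h0 : 0 < ρ) : InjOn (fun x : ℝ => Real.exp (ρ * x)) univ := by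
  intro x _ y _ h
  have := Real.exp_injective h
  exact mul_left_cancel₀ h0.ne' this

lemma integrable_logKDensity {ρ : ℝ} (h0 : 0 < ρ) (h1 : ρ < 1) :
    Integrable (logKDensity ρ) := by
  have := integrableOn_kDensity h0 h1
  rw [← image_exp_mul h0, integrableOn_image_iff_integrableOn_abs_deriv_smul MeasurableSet.univ
    (fun x _ => hasDerivWithinAt_exp_mul ρ x) (injOn_exp_mul h0), integrableOn_univ] at this
  refine this.congr (ae_of_all _ fun x => ?_)
  simp only [smul_eq_mul, logKDensity]
  rw [abs_of_pos (by positivity)]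

lemma integral_kMeasure {ρ : ℝ} (h0 : 0 < ρ) (h1 : ρ < 1) (f : ℝ → ℂ) :
    ∫ k, f k ∂kMeasure ρ = ∫ x : ℝ, (logKDensity ρ x : ℂ) * f (Real.exp (ρ * x)) := by
  rw [kMeasure_eq_restrict, integral_withDensity_eq_integral_toReal_smul
    (measurable_kDensity ρ).ennreal_ofReal (ae_of_all _ fun x => ENNReal.ofReal_lt_top),
    ← image_exp_mul h0, integral_image_eq_integral_abs_deriv_smul MeasurableSet.univ
    (fun x _ => hasDerivWithinAt_exp_mul ρ x) (injOn_exp_mul h0), setIntegral_univ]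
  congr 1
  ext x
  rw [abs_of_pos (by positivity), ENNReal.toReal_ofReal (kDensity_nonneg h0 h1 _), logKDensity,
    Complex.real_smul, Complex.real_smul]
  push_cast
  ring

/-! ### The Stieltjes transform of K_ρ by contour integration -/

/-- The function `w ↦ 1 / (1 + e^{ρ w})`, holomorphic in the strip `|Im w| < π / ρ`. -/
noncomputable def logisticFun (ρ : ℝ) (w : ℂ) : ℂ := (1 + Complex.exp (ρ * w))⁻¹

lemma one_add_exp_ne_zero {w : ℂ} (h : |w.im| < Real.pi) : 1 + Complex.exp w ≠ 0 := by
  intro h0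
  have h1 : Complex.exp w = Complex.exp (Real.pi * Complex.I) := by
    rw [Complex.exp_pi_mul_I]; linear_combination h0
  obtain ⟨n, hn⟩ := Complex.exp_eq_exp_iff_exists_int.1 h1
  have h2 := congrArg Complex.im hn
  simp at h2
  rw [abs_lt, h2] at h
  have hp := Real.pi_pos
  have h3 : (-1 : ℝ) < n := by
    by_contra! h'
    nlinarith
  have h4 : (n : ℝ) < 0 := by
    by_contra! h'
    nlinarith
  norm_cast at h3 h4
  omega

lemma differentiableAt_logisticFun {ρ : ℝ} (h0 : 0 < ρ) (h1 : ρ < 1) {w : ℂ}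
    (hw : |w.im| ≤ Real.pi) : DifferentiableAt ℂ (logisticFun ρ) w := by
  unfold logisticFun
  refine DifferentiableAt.inv (by fun_prop) (one_add_exp_ne_zero ?_)
  simp only [Complex.mul_im, Complex.ofReal_re, Complex.ofReal_im, zero_mul, add_zero, abs_mul,
    abs_of_pos h0]
  nlinarith [Real.pi_pos, abs_nonneg w.im]

/-- The reason for using the strip of half-width π: the denominators on its two edges are complex
conjugate, and their product is the quadratic in the density of K_ρ. The density is thus the jump of
a holomorphic function. -/
lemma logisticFun_sub_logisticFun {ρ : ℝ} (h0 : 0 < ρ) (h1 : ρ < 1) (x : ℝ) :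
    logisticFun ρ (x - Real.pi * Complex.I) - logisticFun ρ (x + Real.pi * Complex.I) =
      2 * Real.pi * Complex.I * logKDensity ρ x := by
  have hd := kDensity_denom_pos h0 h1 (Real.exp (ρ * x))
  set E : ℝ := Real.exp (ρ * x) with hE
  set θ : ℝ := Real.pi * ρ with hθ
  have e1 : Complex.exp (ρ * (x - Real.pi * Complex.I)) =
      E * (Real.cos θ - Real.sin θ * Complex.I) := by
    rw [show (ρ : ℂ) * (x - Real.pi * Complex.I) = ((ρ * x : ℝ) : ℂ) + ((-θ : ℝ) : ℂ) * Complex.I by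
      rw [hθ]; push_cast; ring, Complex.exp_add, Complex.exp_mul_I, hE]
    push_cast
    rw [Complex.cos_neg, Complex.sin_neg]
    ring
  have e2 : Complex.exp (ρ * (x + Real.pi * Complex.I)) =
      E * (Real.cos θ + Real.sin θ * Complex.I) := by
    rw [show (ρ : ℂ) * (x + Real.pi * Complex.I) = ((ρ * x : ℝ) : ℂ) + ((θ : ℝ) : ℂ) * Complex.I by
      rw [hθ]; push_cast; ring, Complex.exp_add, Complex.exp_mul_I, hE]
    push_cast
    ring
  have n1 := one_add_exp_ne_zero (w := ρ * (x - Real.pi * Complex.I)) (by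
    simp only [Complex.mul_im, Complex.sub_im, Complex.ofReal_re, Complex.ofReal_im]
    simp [abs_mul, abs_of_pos h0, abs_of_pos Real.pi_pos]
    nlinarith [Real.pi_pos])
  have n2 := one_add_exp_ne_zero (w := ρ * (x + Real.pi * Complex.I)) (by
    simp only [Complex.mul_im, Complex.add_im, Complex.ofReal_re, Complex.ofReal_im]
    simp [abs_mul, abs_of_pos h0, abs_of_pos Real.pi_pos]
    nlinarith [Real.pi_pos])
  rw [logisticFun, logisticFun, logKDensity, kDensity, if_pos (Real.exp_pos _), ← hE, ← hθ]
  rw [e1] at n1 ⊢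
  rw [e2] at n2 ⊢
  have hθ0 : (ρ : ℂ) ≠ 0 := by exact_mod_cast h0.ne'
  have hπ : (Real.pi : ℂ) ≠ 0 := by exact_mod_cast Real.pi_ne_zero
  have hd' : ((E : ℂ) ^ 2 + 2 * E * (Real.cos θ) + 1) ≠ 0 := by exact_mod_cast hd.ne'
  have hsc : (Real.sin θ : ℂ) ^ 2 + (Real.cos θ : ℂ) ^ 2 = 1 := by
    exact_mod_cast Real.sin_sq_add_cos_sq θ
  have hprod : (1 + (E : ℂ) * (Real.cos θ - Real.sin θ * Complex.I)) *
      (1 + (E : ℂ) * (Real.cos θ + Real.sin θ * Complex.I)) =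
        (E : ℂ) ^ 2 + 2 * E * (Real.cos θ) + 1 := by
    linear_combination (E : ℂ) ^ 2 * hsc - (E : ℂ) ^ 2 * (Real.sin θ) ^ 2 * Complex.I_sq
  rw [inv_sub_inv n1 n2, hprod, hθ]
  push_cast
  rw [hθ] at hd'
  push_cast at hd'
  field_simp
  ring

/-- `(g w - g v) e^w / (e^w - e^v)` with `g = logisticFun ρ`, continued to `w = v`. -/
noncomputable def stripKernel (ρ : ℝ) (v w : ℂ) : ℂ :=
  dslope (logisticFun ρ) v w / dslope Complex.exp v w * Complex.exp w

lemma dslope_exp_ne_zero {v w : ℂ} (hv : |v.im| ≤ Real.pi / 2) (hw : |w.im| ≤ Real.pi) :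
    dslope Complex.exp v w ≠ 0 := by
  by_cases h : w = v
  · rw [h, dslope_same]
    simp
  · rw [dslope_of_ne _ h, slope_def_field]
    refine div_ne_zero ?_ (sub_ne_zero.2 h)
    rw [sub_ne_zero]
    -- Since |Im (w - v)| ≤ 3π/2 < 2π, equal exponentials force w = v.
    intro he
    obtain ⟨n, hn⟩ := Complex.exp_eq_exp_iff_exists_int.1 he
    have h2 := congrArg Complex.im hn
    simp at h2
    rw [abs_le] at hv hw
    have hp := Real.pi_pos
    have h3 : (-1 : ℝ) < n := by
      by_contra! h'
      nlinarith
    have h4 : (n : ℝ) < 1 := by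
      by_contra! h'
      nlinarith
    norm_cast at h3 h4
    obtain rfl : n = 0 := by omega
    exact h (by simpa using hn)

lemma stripKernel_of_ne {ρ : ℝ} {v w : ℂ} (h : w ≠ v) :
    stripKernel ρ v w = (logisticFun ρ w - logisticFun ρ v) * Complex.exp w /
      (Complex.exp w - Complex.exp v) := by
  rw [stripKernel, dslope_of_ne _ h, dslope_of_ne _ h, slope_def_field, slope_def_field,
    div_div_div_cancel_right₀ (sub_ne_zero.2 h)]
  ring

/-- The singularity at v is removable, and writing the kernel as a quotient of `dslope`s removes it;
the denominator has no other zero in the strip. -/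
lemma differentiableOn_stripKernel {ρ : ℝ} (h0 : 0 < ρ) (h1 : ρ < 1) {v : ℂ}
    (hv : |v.im| ≤ Real.pi / 2) {s : Set ℂ} (hs : s ∈ 𝓝 v) (hsub : ∀ w ∈ s, |w.im| ≤ Real.pi) :
    DifferentiableOn ℂ (stripKernel ρ v) s := by
  unfold stripKernel
  refine DifferentiableOn.mul (DifferentiableOn.div ?_ ?_ ?_)
    Complex.differentiable_exp.differentiableOn
  · rw [Complex.differentiableOn_dslope hs]
    exact fun w hw => (differentiableAt_logisticFun h0 h1 (hsub w hw)).differentiableWithinAt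
  · rw [Complex.differentiableOn_dslope hs]
    exact Complex.differentiable_exp.differentiableOn
  · exact fun w hw => dslope_exp_ne_zero hv (hsub w hw)

lemma norm_logisticFun_le_right {ρ : ℝ} {w : ℂ} (h : 0 < ρ * w.re) :
    ‖logisticFun ρ w‖ ≤ (Real.exp (ρ * w.re) - 1)⁻¹ := by
  have h1 : 1 < Real.exp (ρ * w.re) := Real.one_lt_exp_iff.2 h
  rw [logisticFun, norm_inv]
  refine inv_anti₀ (by linarith) ?_
  have := norm_sub_norm_le (Complex.exp (ρ * w)) (-1)
  rw [Complex.norm_exp, norm_neg, norm_one, sub_neg_eq_add, add_comm] at this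
  simpa [add_comm] using this

lemma norm_logisticFun_le_left {ρ : ℝ} {w : ℂ} (h : ρ * w.re < 0) :
    ‖logisticFun ρ w‖ ≤ (1 - Real.exp (ρ * w.re))⁻¹ := by
  have h1 : Real.exp (ρ * w.re) < 1 := Real.exp_lt_one_iff.2 h
  rw [logisticFun, norm_inv]
  refine inv_anti₀ (by linarith) ?_
  have := norm_sub_norm_le (1 : ℂ) (-Complex.exp (ρ * w))
  rw [norm_neg, Complex.norm_exp, norm_one, sub_neg_eq_add] at this
  simpa using this

/-- Dividing numerator and denominator by e^w shows that the kernel tends to -g(v) at the right end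
of the strip, where g = `logisticFun ρ`. This is the only edge contribution that survives in the
limit. -/
lemma norm_stripKernel_add_le {ρ : ℝ} (h0 : 0 < ρ) {v w : ℂ} (h : v.re < w.re) (h' : 0 < w.re) :
    ‖stripKernel ρ v w + logisticFun ρ v‖ ≤
      ((Real.exp (ρ * w.re) - 1)⁻¹ + ‖logisticFun ρ v‖ * Real.exp (v.re - w.re)) /
        (1 - Real.exp (v.re - w.re)) := by
  have hne : w ≠ v := fun e => by rw [e] at h; exact lt_irrefl _ h
  have hlt : Real.exp (v.re - w.re) < 1 := Real.exp_lt_one_iff.2 (by linarith)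
  have hnorm : ‖Complex.exp (v - w)‖ = Real.exp (v.re - w.re) := by
    rw [Complex.norm_exp, Complex.sub_re]
  have hge : 1 - Real.exp (v.re - w.re) ≤ ‖1 - Complex.exp (v - w)‖ := by
    have := norm_sub_norm_le (1 : ℂ) (Complex.exp (v - w))
    rwa [hnorm, norm_one] at this
  have hd : 1 - Complex.exp (v - w) ≠ 0 := by
    rw [← norm_pos_iff]; linarith
  have hv : Complex.exp v = Complex.exp (v - w) * Complex.exp w := by
    rw [← Complex.exp_add, sub_add_cancel]
  have : stripKernel ρ v w + logisticFun ρ v =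
      (logisticFun ρ w - logisticFun ρ v * Complex.exp (v - w)) / (1 - Complex.exp (v - w)) := by
    rw [stripKernel_of_ne hne, hv]
    have he := Complex.exp_ne_zero w
    rw [show Complex.exp w - Complex.exp (v - w) * Complex.exp w =
      (1 - Complex.exp (v - w)) * Complex.exp w by ring, mul_div_mul_right _ _ he]
    field_simp
    ring
  rw [this, norm_div]
  refine div_le_div₀ ?_ ?_ (by linarith) hge
  · have := Real.one_lt_exp_iff.2 (mul_pos h0 h')
    have : 0 ≤ (Real.exp (ρ * w.re) - 1)⁻¹ := inv_nonneg.2 (by linarith)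
    positivity
  · refine (norm_sub_le _ _).trans (add_le_add (norm_logisticFun_le_right (mul_pos h0 h')) ?_)
    rw [norm_mul, hnorm]

lemma norm_stripKernel_le {ρ : ℝ} (h0 : 0 < ρ) {v w : ℂ} (h : w.re < v.re) (h' : w.re < 0) :
    ‖stripKernel ρ v w‖ ≤
      ((1 - Real.exp (ρ * w.re))⁻¹ + ‖logisticFun ρ v‖) * Real.exp (w.re - v.re) /
        (1 - Real.exp (w.re - v.re)) := by
  have hne : w ≠ v := fun e => by rw [e] at h; exact lt_irrefl _ h
  have hlt : Real.exp (w.re - v.re) < 1 := Real.exp_lt_one_iff.2 (by linarith)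
  have hnorm : ‖Complex.exp (w - v)‖ = Real.exp (w.re - v.re) := by
    rw [Complex.norm_exp, Complex.sub_re]
  have hge : 1 - Real.exp (w.re - v.re) ≤ ‖Complex.exp (w - v) - 1‖ := by
    have := norm_sub_norm_le (1 : ℂ) (Complex.exp (w - v))
    rwa [hnorm, norm_one, norm_sub_rev] at this
  have hw : Complex.exp w = Complex.exp (w - v) * Complex.exp v := by
    rw [← Complex.exp_add, sub_add_cancel]
  have : stripKernel ρ v w =
      (logisticFun ρ w - logisticFun ρ v) * Complex.exp (w - v) / (Complex.exp (w - v) - 1) := by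
    rw [stripKernel_of_ne hne, hw]
    have he := Complex.exp_ne_zero v
    rw [show Complex.exp (w - v) * Complex.exp v - Complex.exp v =
      (Complex.exp (w - v) - 1) * Complex.exp v by ring, ← mul_assoc, mul_div_mul_right _ _ he]
  have hpos : 0 ≤ (1 - Real.exp (ρ * w.re))⁻¹ := by
    have := Real.exp_lt_one_iff.2 (mul_neg_of_pos_of_neg h0 h')
    exact inv_nonneg.2 (by linarith)
  rw [this, norm_div, norm_mul, hnorm]
  refine div_le_div₀ (by positivity) ?_ (by linarith) hge
  gcongr
  refine (norm_sub_le _ _).trans ?_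
  gcongr
  exact norm_logisticFun_le_left (mul_neg_of_pos_of_neg h0 h')

lemma tendsto_integral_of_norm_le {f : ℝ → ℝ → ℂ} {e : ℝ → ℝ} {a b : ℝ}
    (hf : ∀ᶠ R in atTop, ∀ y, ‖f R y‖ ≤ e R) (he : Tendsto e atTop (𝓝 0)) :
    Tendsto (fun R => ∫ y in a..b, f R y) atTop (𝓝 0) := by
  have := he.mul_const |b - a|
  rw [zero_mul] at this
  refine squeeze_zero_norm' ?_ this
  filter_upwards [hf] with R hR
  exact intervalIntegral.norm_integral_le_of_norm_le_const fun y _ => hR y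

lemma tendsto_integral_stripKernel_right {ρ : ℝ} (h0 : 0 < ρ) (v : ℂ) :
    Tendsto (fun R : ℝ => ∫ y in (-Real.pi)..Real.pi,
      (stripKernel ρ v (R + y * Complex.I) + logisticFun ρ v)) atTop (𝓝 0) := by
  refine tendsto_integral_of_norm_le (e := fun R =>
    ((Real.exp (ρ * R) - 1)⁻¹ + ‖logisticFun ρ v‖ * Real.exp (v.re - R)) /
        (1 - Real.exp (v.re - R))) ?_ ?_
  · filter_upwards [eventually_gt_atTop 0, eventually_gt_atTop v.re] with R hR hR' y
    simpa using norm_stripKernel_add_le h0 (v := v) (w := R + y * Complex.I) (by simpa using hR')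
      (by simpa using hR)
  · have e1 : Tendsto (fun R : ℝ => Real.exp (v.re - R)) atTop (𝓝 0) :=
      Real.tendsto_exp_atBot.comp (tendsto_atBot_add_const_left _ _ tendsto_neg_atTop_atBot)
    have e2 : Tendsto (fun R : ℝ => (Real.exp (ρ * R) - 1)⁻¹) atTop (𝓝 0) := by
      refine tendsto_inv_atTop_zero.comp (tendsto_atTop_add_const_right _ _ ?_)
      exact Real.tendsto_exp_atTop.comp (tendsto_id.const_mul_atTop h0)
    have := (e2.add (e1.const_mul ‖logisticFun ρ v‖)).div (e1.const_sub 1) (by norm_num)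
    simpa [Pi.div_def] using this

lemma tendsto_integral_stripKernel_left {ρ : ℝ} (h0 : 0 < ρ) (v : ℂ) :
    Tendsto (fun R : ℝ => ∫ y in (-Real.pi)..Real.pi,
      stripKernel ρ v (((-R : ℝ) : ℂ) + y * Complex.I)) atTop (𝓝 0) := by
  refine tendsto_integral_of_norm_le (e := fun R =>
    ((1 - Real.exp (ρ * -R))⁻¹ + ‖logisticFun ρ v‖) * Real.exp (-R - v.re) /
        (1 - Real.exp (-R - v.re))) ?_ ?_
  · filter_upwards [eventually_gt_atTop 0, eventually_gt_atTop (-v.re)] with R hR hR' y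
    simpa using norm_stripKernel_le h0 (v := v) (w := ((-R : ℝ) : ℂ) + y * Complex.I)
      (by simp; linarith) (by simpa using hR)
  · have e1 : Tendsto (fun R : ℝ => Real.exp (-R - v.re)) atTop (𝓝 0) :=
      Real.tendsto_exp_atBot.comp (tendsto_atBot_add_const_right _ _ tendsto_neg_atTop_atBot)
    have e2 : Tendsto (fun R : ℝ => Real.exp (ρ * -R)) atTop (𝓝 0) :=
      Real.tendsto_exp_atBot.comp (tendsto_neg_atTop_atBot.const_mul_atBot h0)
    have := (((((e2.const_sub 1).inv₀ (by norm_num)).add_const ‖logisticFun ρ v‖).mul e1).div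
      (e1.const_sub 1) (by norm_num))
    simpa [Pi.div_def] using this

/-- On both lines e^w = -e^x, so e^w / (e^w - e^v) has the common value 1 / (1 + e^(v-x)). The terms
with g(v) cancel and only the jump of g remains. -/
lemma stripKernel_horizontal {ρ : ℝ} (h0 : 0 < ρ) (h1 : ρ < 1) {v : ℂ}
    (hv : |v.im| ≤ Real.pi / 2) (x : ℝ) :
    stripKernel ρ v (x + ((-Real.pi : ℝ) : ℂ) * Complex.I) -
      stripKernel ρ v (x + Real.pi * Complex.I) =
      2 * Real.pi * Complex.I * (logKDensity ρ x * (1 + Complex.exp (v - x))⁻¹) := by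
  have hp := Real.pi_pos
  rw [abs_le] at hv
  have n1 : (x + ((-Real.pi : ℝ) : ℂ) * Complex.I) ≠ v := fun e => by
    rw [← e] at hv; simp at hv; linarith
  have n2 : (x + Real.pi * Complex.I) ≠ v := fun e => by
    rw [← e] at hv; simp at hv; linarith
  have e1 : Complex.exp (x + ((-Real.pi : ℝ) : ℂ) * Complex.I) = -Complex.exp x := by
    rw [Complex.exp_add]; push_cast; rw [neg_mul, Complex.exp_neg, Complex.exp_pi_mul_I]; norm_num
  have e2 : Complex.exp (x + Real.pi * Complex.I) = -Complex.exp x := by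
    rw [Complex.exp_add, Complex.exp_pi_mul_I]; ring
  have hd : 1 + Complex.exp (v - x) ≠ 0 := one_add_exp_ne_zero (by
    simp [abs_lt]; constructor <;> linarith)
  have hx := Complex.exp_ne_zero x
  have hv' : Complex.exp v = Complex.exp (v - x) * Complex.exp x := by
    rw [← Complex.exp_add, sub_add_cancel]
  have hl := logisticFun_sub_logisticFun h0 h1 x
  rw [stripKernel_of_ne n1, stripKernel_of_ne n2, e1, e2, hv', ← mul_assoc, ← hl]
  rw [show -Complex.exp x - Complex.exp (v - x) * Complex.exp x =
    (1 + Complex.exp (v - x)) * (-Complex.exp x) by ring,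
    mul_div_mul_right _ _ (neg_ne_zero.2 hx), mul_div_mul_right _ _ (neg_ne_zero.2 hx)]
  push_cast
  rw [neg_mul, ← sub_eq_add_neg]
  field_simp
  ring

/-- Here e^w has nonnegative real part. This bounds the Stieltjes kernel by one, up to and including
the imaginary axis needed for characteristic functions. -/
lemma one_le_norm_one_add_exp {w : ℂ} (hw : |w.im| ≤ Real.pi / 2) :
    1 ≤ ‖1 + Complex.exp w‖ := by
  refine le_trans ?_ (Complex.re_le_norm _)
  rw [Complex.add_re, Complex.one_re, Complex.exp_re]
  have := Real.cos_nonneg_of_neg_pi_div_two_le_of_le (abs_le.1 hw).1 (abs_le.1 hw).2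
  have := mul_nonneg (Real.exp_pos w.re).le this
  linarith

lemma integrable_logKDensity_mul {ρ : ℝ} (h0 : 0 < ρ) (h1 : ρ < 1) {v : ℂ}
    (hv : |v.im| ≤ Real.pi / 2) :
    Integrable (fun x : ℝ => (logKDensity ρ x : ℂ) * (1 + Complex.exp (v - x))⁻¹) := by
  refine (integrable_logKDensity h0 h1).ofReal.mul_bdd (c := 1) ?_ (ae_of_all _ fun x => ?_)
  · exact (by fun_prop : Measurable fun x : ℝ => (1 + Complex.exp (v - x))⁻¹).aestronglyMeasurable
  · rw [norm_inv]
    exact inv_le_one_of_one_le₀ (one_le_norm_one_add_exp (by simpa using hv))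

/-- The Stieltjes transform of the law of `K_ρ`, in logarithmic coordinates. -/
lemma integral_logKDensity_mul {ρ : ℝ} (h0 : 0 < ρ) (h1 : ρ < 1) {v : ℂ}
    (hv : |v.im| ≤ Real.pi / 2) :
    ∫ x : ℝ, (logKDensity ρ x : ℂ) * (1 + Complex.exp (v - x))⁻¹ = (1 + Complex.exp (ρ * v))⁻¹ := by
  have hp := Real.pi_pos
  have hv2 := abs_le.1 hv
  -- Cauchy's theorem on [-R, R] × [-π, π]. Adding g(v) to the right-edge integrand isolates 2πi
  -- g(v) and leaves two vertical integrals that vanish as R → ∞.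
  have key : ∀ R : ℝ, |v.re| < R →
      (2 * Real.pi * Complex.I *
        ∫ x in (-R)..R, (logKDensity ρ x : ℂ) * (1 + Complex.exp (v - x))⁻¹) =
      2 * Real.pi * Complex.I * logisticFun ρ v -
      Complex.I * (∫ y in (-Real.pi)..Real.pi,
        (stripKernel ρ v (R + y * Complex.I) + logisticFun ρ v)) +
      Complex.I * (∫ y in (-Real.pi)..Real.pi,
        stripKernel ρ v (((-R : ℝ) : ℂ) + y * Complex.I)) := by
    intro R hR
    have hR2 := abs_lt.1 hR
    have hR0 : 0 < R := (abs_nonneg _).trans_lt hR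
    set s : Set ℂ := Icc (-R) R ×ℂ Icc (-Real.pi) Real.pi with hs
    have hsv : s ∈ 𝓝 v := by
      rw [hs]
      exact Complex.continuous_re.continuousAt.preimage_mem_nhds (Icc_mem_nhds hR2.1 hR2.2)
        |> fun h => inter_mem h (Complex.continuous_im.continuousAt.preimage_mem_nhds
          (Icc_mem_nhds (by linarith) (by linarith)))
    have hdiff := differentiableOn_stripKernel h0 h1 hv hsv
      (fun w hw => abs_le.2 ⟨hw.2.1, hw.2.2⟩)
    have hrect := Complex.integral_boundary_rect_eq_zero_of_differentiableOn (stripKernel ρ v)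
      (⟨-R, -Real.pi⟩ : ℂ) (⟨R, Real.pi⟩ : ℂ) (by
        simpa only [uIcc_of_le (show -R ≤ R by linarith),
          uIcc_of_le (show -Real.pi ≤ Real.pi by linarith)] using hdiff)
    simp only [smul_eq_mul] at hrect
    have hcont := hdiff.continuousOn
    have i1 : IntervalIntegrable (fun x : ℝ => stripKernel ρ v
        (x + ((-Real.pi : ℝ) : ℂ) * Complex.I)) volume (-R) R := by
      refine ContinuousOn.intervalIntegrable ?_
      rw [uIcc_of_le (by linarith)]
      refine hcont.comp (by fun_prop) fun x hx => ?_
      simp only [hs, Complex.mem_reProdIm]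
      simpa [hp.le] using hx
    have i2 : IntervalIntegrable (fun x : ℝ => stripKernel ρ v
        (x + Real.pi * Complex.I)) volume (-R) R := by
      refine ContinuousOn.intervalIntegrable ?_
      rw [uIcc_of_le (by linarith)]
      refine hcont.comp (by fun_prop) fun x hx => ?_
      simp only [hs, Complex.mem_reProdIm]
      simpa [hp.le] using hx
    have i3 : IntervalIntegrable (fun y : ℝ => stripKernel ρ v
        (R + y * Complex.I)) volume (-Real.pi) Real.pi := by
      refine ContinuousOn.intervalIntegrable ?_
      rw [uIcc_of_le (by linarith)]
      refine hcont.comp (by fun_prop) fun x hx => ?_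
      simp only [hs, Complex.mem_reProdIm]
      simpa [hR0.le] using hx
    rw [← intervalIntegral.integral_sub i1 i2] at hrect
    simp only [stripKernel_horizontal h0 h1 hv] at hrect
    rw [intervalIntegral.integral_const_mul] at hrect
    rw [intervalIntegral.integral_add i3 intervalIntegrable_const,
      intervalIntegral.integral_const, Complex.real_smul]
    push_cast at hrect ⊢
    linear_combination hrect
  have hlim1 := ((intervalIntegral_tendsto_integral (integrable_logKDensity_mul h0 h1 hv)
    tendsto_neg_atTop_atBot tendsto_id).const_mul (2 * Real.pi * Complex.I))
  have hlim2 : Tendsto (fun R : ℝ => 2 * Real.pi * Complex.I * logisticFun ρ v -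
      Complex.I * (∫ y in (-Real.pi)..Real.pi,
        (stripKernel ρ v (R + y * Complex.I) + logisticFun ρ v)) +
      Complex.I * (∫ y in (-Real.pi)..Real.pi,
        stripKernel ρ v (((-R : ℝ) : ℂ) + y * Complex.I))) atTop
      (𝓝 (2 * Real.pi * Complex.I * logisticFun ρ v)) := by
    have := ((tendsto_integral_stripKernel_right h0 v).const_mul Complex.I).const_sub
      (2 * Real.pi * Complex.I * logisticFun ρ v) |>.add
      ((tendsto_integral_stripKernel_left h0 v).const_mul Complex.I)
    simpa [Pi.div_def] using this
  have := tendsto_nhds_unique (hlim1.congr' ?_) hlim2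
  · exact mul_left_cancel₀ Complex.two_pi_I_ne_zero this
  · filter_upwards [eventually_gt_atTop |v.re|] with R hR
    exact key R hR

lemma exp_mul_rpow_neg_inv {ρ : ℝ} (h0 : 0 < ρ) (x : ℝ) :
    Real.exp (ρ * x) ^ (-ρ⁻¹) = Real.exp (-x) := by
  rw [← Real.exp_mul]
  congr 1
  field_simp

lemma integral_kMeasure_stieltjes {ρ : ℝ} (h0 : 0 < ρ) (h1 : ρ < 1) {v : ℂ}
    (hv : |v.im| ≤ Real.pi / 2) :
    ∫ k, (1 + Complex.exp v * ((k ^ (-ρ⁻¹) : ℝ) : ℂ))⁻¹ ∂kMeasure ρ =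
      (1 + Complex.exp (ρ * v))⁻¹ := by
  rw [integral_kMeasure h0 h1, ← integral_logKDensity_mul h0 h1 hv]
  congr 1
  ext x
  rw [exp_mul_rpow_neg_inv h0, sub_eq_add_neg, Complex.exp_add]
  push_cast
  rfl

lemma integral_kMeasure_stieltjes_real {ρ : ℝ} (h0 : 0 < ρ) (h1 : ρ < 1) {u : ℝ} (hu : 0 ≤ u) :
    ∫ k, (1 + u * k ^ (-ρ⁻¹))⁻¹ ∂kMeasure ρ = (1 + u ^ ρ)⁻¹ := by
  rcases hu.eq_or_lt with rfl | hu
  · have := isProbabilityMeasure_kMeasure h0 h1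
    simp [Real.zero_rpow h0.ne']
  have := integral_kMeasure_stieltjes h0 h1 (v := (Real.log u : ℝ)) (by simp; positivity)
  rw [← Complex.ofReal_exp, Real.exp_log hu, ← Complex.ofReal_mul, ← Complex.ofReal_exp, mul_comm ρ,
    ← Real.rpow_def_of_pos hu] at this
  apply Complex.ofReal_injective
  rw [← integral_complex_ofReal]
  push_cast
  exact_mod_cast this

/-! ### The standard exponential law -/

lemma expMeasure_one_eq_restrict :
    expMeasure 1 = (volume.restrict (Ioi (0 : ℝ))).withDensity
      (fun x => ENNReal.ofReal (Real.exp (-x))) := by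
  rw [← withDensity_indicator measurableSet_Ioi]
  change volume.withDensity (exponentialPDF 1) = _
  refine withDensity_congr_ae ?_
  filter_upwards [Measure.ae_ne volume (0 : ℝ)] with x hx
  rcases hx.lt_or_gt with h | h
  · rw [exponentialPDF_of_neg h, indicator_of_notMem (by simpa using h.le)]
  · rw [exponentialPDF_of_nonneg h.le, indicator_of_mem (by simpa using h)]
    simp

lemma expMeasure_one_ae_pos : ∀ᵐ x ∂expMeasure 1, 0 < x := by
  rw [expMeasure_one_eq_restrict]
  exact (withDensity_absolutelyContinuous _ _).ae_le (ae_restrict_mem measurableSet_Ioi)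

instance isProbabilityMeasure_expMeasure_one : IsProbabilityMeasure (expMeasure 1) :=
  isProbabilityMeasure_expMeasure one_pos

lemma integral_expMeasure_one {E : Type*} [NormedAddCommGroup E] [NormedSpace ℝ E] (f : ℝ → E) :
    ∫ x, f x ∂expMeasure 1 = ∫ x in Ioi (0 : ℝ), Real.exp (-x) • f x := by
  rw [expMeasure_one_eq_restrict, integral_withDensity_eq_integral_toReal_smul (by fun_prop)
    (ae_of_all _ fun x => ENNReal.ofReal_lt_top)]
  simp_rw [ENNReal.toReal_ofReal (Real.exp_pos _).le]

lemma integral_cexp_expMeasure_one {w : ℂ} (hw : -1 < w.re) :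
    ∫ x : ℝ, Complex.exp (-(w * x)) ∂expMeasure 1 = (1 + w)⁻¹ := by
  rw [integral_expMeasure_one]
  have h := integral_exp_mul_complex_Ioi (a := -(1 + w)) (by simp; linarith) 0
  rw [Complex.ofReal_zero, mul_zero, Complex.exp_zero, neg_div_neg_eq, one_div] at h
  rw [← h]
  congr 1
  ext x
  rw [Complex.real_smul, Complex.ofReal_exp, ← Complex.exp_add]
  congr 1
  push_cast
  ring

lemma integral_exp_expMeasure_one {u : ℝ} (hu : 0 ≤ u) :
    ∫ x, Real.exp (-(u * x)) ∂expMeasure 1 = (1 + u)⁻¹ := by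
  have := integral_cexp_expMeasure_one (w := u) (by simp; linarith)
  apply Complex.ofReal_injective
  rw [← integral_complex_ofReal]
  push_cast
  exact this

lemma measureReal_expMeasure_one_Ici {t : ℝ} (ht : 0 ≤ t) :
    (expMeasure 1).real (Ici t) = Real.exp (-t) := by
  have hac : expMeasure 1 ≪ volume := by
    rw [expMeasure_one_eq_restrict]
    exact (withDensity_absolutelyContinuous _ _).trans Measure.absolutelyContinuous_restrict
  have h1 := cdf_expMeasure_eq one_pos t
  rw [if_pos ht, cdf_eq_real, one_mul] at h1
  have : NullSingletonClass (expMeasure 1) := ⟨fun x => hac (by simp)⟩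
  have h2 : (expMeasure 1).real (Ici t) = (expMeasure 1).real (Ioi t) :=
    measureReal_congr Ioi_ae_eq_Ici.symm
  rw [h2, ← compl_Iic, probReal_compl_eq_one_sub measurableSet_Iic, h1]
  ring

/-! ### From the stable characteristic function to a Laplace transform -/

lemma charFun_map_prod {μ ν : Measure ℝ} [IsProbabilityMeasure μ] [IsProbabilityMeasure ν]
    {f : ℝ × ℝ → ℝ} (hf : Measurable f) (t : ℝ) :
    charFun ((μ.prod ν).map f) t = ∫ x, ∫ y, Complex.exp (t * f (x, y) * Complex.I) ∂ν ∂μ := by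
  rw [charFun_apply_real, integral_map hf.aemeasurable
    (by fun_prop : Measurable _).aestronglyMeasurable, integral_prod]
  refine Integrable.of_bound (by fun_prop : Measurable _).aestronglyMeasurable 1
    (ae_of_all _ fun p => ?_)
  rw [← Complex.ofReal_mul, Complex.norm_exp_ofReal_mul_I]

/-- The law of `E ^ (1 / α) * S`, with `E` a standard exponential variable independent of a
variable `S` with law `ν`. -/
noncomputable def expScale (α : ℝ) (ν : Measure ℝ) : Measure ℝ :=
  ((expMeasure 1).prod ν).map (fun p => p.1 ^ α⁻¹ * p.2)

/-- The law of `E * K_α ^ (-1 / α)`, with `E` a standard exponential variable independent of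
`K_α`. -/
noncomputable def expMixture (α : ℝ) : Measure ℝ :=
  ((kMeasure α).prod (expMeasure 1)).map (fun p => p.2 * p.1 ^ (-α⁻¹))

lemma isProbabilityMeasure_expScale (α : ℝ) {ν : Measure ℝ} [IsProbabilityMeasure ν] :
    IsProbabilityMeasure (expScale α ν) :=
  Measure.isProbabilityMeasure_map (by fun_prop)

lemma isProbabilityMeasure_expMixture {α : ℝ} (h0 : 0 < α) (h1 : α < 1) :
    IsProbabilityMeasure (expMixture α) :=
  have := isProbabilityMeasure_kMeasure h0 h1
  Measure.isProbabilityMeasure_map (by fun_prop)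

/-- `(-i t) ^ α`, the exponent of the one-sided strictly stable law. -/
noncomputable def stableExponent (α t : ℝ) : ℂ :=
  ((|t| ^ α : ℝ) : ℂ) *
      Complex.exp (-(1 / 2) * Complex.I * ((Real.pi * 1 * α * SignType.sign t : ℝ) : ℂ))

lemma stableExponent_re_nonneg {α : ℝ} (h0 : 0 < α) (h1 : α ≤ 1) (t : ℝ) :
    0 ≤ (stableExponent α t).re := by
  unfold stableExponent
  rw [Complex.re_ofReal_mul]
  refine mul_nonneg (by positivity) ?_
  rw [Complex.exp_re]
  refine mul_nonneg (Real.exp_pos _).le ?_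
  have hp := Real.pi_pos
  have h : Real.pi * α ≤ Real.pi := by nlinarith
  have h' : 0 < Real.pi * α := by positivity
  apply Real.cos_nonneg_of_neg_pi_div_two_le_of_le
  all_goals
    simp
    rcases lt_trichotomy t 0 with ht | ht | ht <;> simp [ht] <;> linarith

/-- By homogeneity of the stable exponent, conditioning on E = e gives exp(-e (-it)^α); integrating
over e gives the resolvent form. -/
lemma charFun_expScale {α : ℝ} (h0 : 0 < α) (h1 : α ≤ 1) {ν : Measure ℝ}
    (hν : IsStrictlyStable α 1 ν) (t : ℝ) :
    charFun (expScale α ν) t = (1 + stableExponent α t)⁻¹ := by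
  have := hν.isProbabilityMeasure
  rw [expScale, charFun_map_prod (by fun_prop),
    ← integral_cexp_expMeasure_one (by linarith [stableExponent_re_nonneg h0 h1 t])]
  refine integral_congr_ae ?_
  filter_upwards [expMeasure_one_ae_pos] with e he
  have he' : 0 < e ^ α⁻¹ := by positivity
  have := hν.charFun_eq (t * e ^ α⁻¹)
  rw [charFun_apply_real] at this
  convert! this using 1
  · congr 1
    ext y
    congr 1
    push_cast
    ring
  · rw [abs_mul, abs_of_pos he', Real.mul_rpow (abs_nonneg _) he'.le, ← Real.rpow_mul he.le,
      inv_mul_cancel₀ h0.ne', Real.rpow_one, sign_mul, sign_pos he', stableExponent]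
    congr 1
    simp only [mul_one]
    push_cast
    ring

lemma charFun_expMixture {α : ℝ} (h0 : 0 < α) (h1 : α < 1) (t : ℝ) :
    charFun (expMixture α) t = (1 + stableExponent α t)⁻¹ := by
  have := isProbabilityMeasure_kMeasure h0 h1
  rw [expMixture, charFun_map_prod (by fun_prop)]
  have hin : ∀ k : ℝ, ∫ y : ℝ, Complex.exp (t * ((y * k ^ (-α⁻¹) : ℝ) : ℂ) * Complex.I)
      ∂expMeasure 1 = (1 + (-(t * Complex.I)) * ((k ^ (-α⁻¹) : ℝ) : ℂ))⁻¹ := by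
    intro k
    rw [← integral_cexp_expMeasure_one (by simp)]
    congr 1
    ext y
    congr 1
    push_cast
    ring
  simp only [hin]
  rcases eq_or_ne t 0 with rfl | ht
  · simp [stableExponent, Real.zero_rpow h0.ne']
  -- This v is a logarithm of -it on the boundary |Im v| = π/2, so that e^(αv) is the stable
  -- exponent.
  set v : ℂ := (Real.log |t| : ℝ) +
    ((-(Real.pi / 2 * SignType.sign t) : ℝ) : ℂ) * Complex.I with hv
  have hvim : |v.im| ≤ Real.pi / 2 := by
    have hp := Real.pi_pos
    rw [hv]
    rcases ht.lt_or_gt with h | h <;> simp [h, abs_of_pos, hp]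
  have hexp : Complex.exp v = -(t * Complex.I) := by
    rw [hv, Complex.exp_add, ← Complex.ofReal_exp, Real.exp_log (abs_pos.2 ht), Complex.exp_mul_I,
      ← Complex.ofReal_cos, ← Complex.ofReal_sin]
    rcases ht.lt_or_gt with h | h
    · simp [h, abs_of_neg]
    · simp [h, abs_of_pos]
  have hexp2 : Complex.exp (α * v) = stableExponent α t := by
    rw [hv, mul_add, Complex.exp_add, ← Complex.ofReal_mul, ← Complex.ofReal_exp, mul_comm α,
      ← Real.rpow_def_of_pos (abs_pos.2 ht), stableExponent]
    congr 2
    push_cast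
    ring
  rw [← hexp, integral_kMeasure_stieltjes h0 h1 hvim, hexp2]

lemma expScale_eq_expMixture {α : ℝ} (h0 : 0 < α) (h1 : α < 1) {ν : Measure ℝ}
    (hν : IsStrictlyStable α 1 ν) : expScale α ν = expMixture α := by
  have := hν.isProbabilityMeasure
  have := isProbabilityMeasure_expScale α (ν := ν)
  have := isProbabilityMeasure_expMixture h0 h1
  refine Measure.ext_of_charFun ?_
  ext t
  rw [charFun_expScale h0 h1.le hν, charFun_expMixture h0 h1]

/-- For α = 1 the exponent |t| exp(-iπ sign(t)/2) equals -it. -/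
lemma IsStrictlyStable.eq_dirac {ν : Measure ℝ} (hν : IsStrictlyStable 1 1 ν) :
    ν = Measure.dirac 1 := by
  have := hν.isProbabilityMeasure
  refine Measure.ext_of_charFun ?_
  ext t
  rw [hν.charFun_eq, charFun_dirac]
  congr 1
  have : ∀ r : ℝ, -(1 / 2) * Complex.I * ((Real.pi * 1 * 1 * r : ℝ) : ℂ) =
      ((-(Real.pi / 2 * r) : ℝ) : ℂ) * Complex.I := by intro r; push_cast; ring
  rw [this, Complex.exp_mul_I, ← Complex.ofReal_cos, ← Complex.ofReal_sin]
  rcases lt_trichotomy t 0 with h | h | h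
  · simp [h, abs_of_neg]
  · simp [h]
  · simp [h, abs_of_pos]

lemma expMixture_ae_pos {α : ℝ} (h0 : 0 < α) (h1 : α < 1) : ∀ᵐ x ∂expMixture α, 0 < x := by
  have := isProbabilityMeasure_kMeasure h0 h1
  rw [expMixture, ae_map_iff (by fun_prop) measurableSet_Ioi]
  filter_upwards [Measure.quasiMeasurePreserving_fst.ae (kMeasure_ae_pos α),
    Measure.quasiMeasurePreserving_snd.ae expMeasure_one_ae_pos] with p hp1 hp2
  positivity

/-- The product E^(1/α) S has the law of the positive variable E K_α^(-1/α). By Fubini some fixed e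
> 0 makes e^(1/α) S positive almost surely, and then so is S. -/
lemma IsStrictlyStable.ae_pos {α : ℝ} (h0 : 0 < α) (h1 : α ≤ 1) {ν : Measure ℝ}
    (hν : IsStrictlyStable α 1 ν) : ∀ᵐ x ∂ν, 0 < x := by
  have := hν.isProbabilityMeasure
  rcases h1.eq_or_lt with rfl | h1
  · rw [hν.eq_dirac, ae_dirac_eq]
    exact one_pos (α := ℝ)
  have h := expMixture_ae_pos h0 h1
  rw [← expScale_eq_expMixture h0 h1 hν, expScale, ae_map_iff (by fun_prop) measurableSet_Ioi] at h
  obtain ⟨e, he, hpos⟩ := ((Measure.ae_ae_of_ae_prod h).and expMeasure_one_ae_pos).exists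
  filter_upwards [he] with s hs
  exact pos_of_mul_pos_right hs (by positivity)

lemma integral_exp_expMixture {α : ℝ} (h0 : 0 < α) (h1 : α < 1) {s : ℝ} (hs : 0 ≤ s) :
    ∫ x, Real.exp (-s * x) ∂expMixture α = (1 + s ^ α)⁻¹ := by
  have := isProbabilityMeasure_kMeasure h0 h1
  rw [← integral_kMeasure_stieltjes_real h0 h1 hs, expMixture, integral_map (by fun_prop)
    (by fun_prop : Measurable _).aestronglyMeasurable, integral_prod]
  · refine integral_congr_ae ?_
    filter_upwards [kMeasure_ae_pos α] with k hk
    rw [← integral_exp_expMeasure_one (by positivity)]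
    congr 1
    ext y
    congr 1
    ring
  · refine Integrable.of_bound (by fun_prop : Measurable _).aestronglyMeasurable 1 ?_
    filter_upwards [Measure.quasiMeasurePreserving_fst.ae (kMeasure_ae_pos α),
      Measure.quasiMeasurePreserving_snd.ae expMeasure_one_ae_pos] with p hp1 hp2
    rw [Real.norm_of_nonneg (Real.exp_pos _).le, Real.exp_le_one_iff, neg_mul, neg_nonpos]
    positivity

/-- If `S` has the one-sided strictly stable law, then `E ^ (1 / α) * S` has the Mittag-Leffler
law. -/
lemma IsStrictlyStable.integral_exp_expScale {α : ℝ} (h0 : 0 < α) (h1 : α ≤ 1) {ν : Measure ℝ}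
    (hν : IsStrictlyStable α 1 ν) {s : ℝ} (hs : 0 ≤ s) :
    ∫ x, Real.exp (-s * x) ∂expScale α ν = (1 + s ^ α)⁻¹ := by
  have := hν.isProbabilityMeasure
  rcases h1.eq_or_lt with rfl | h1
  · rw [hν.eq_dirac, Real.rpow_one, ← integral_exp_expMeasure_one hs, expScale,
      Measure.prod_dirac, Measure.map_map (by fun_prop) (by fun_prop),
      integral_map (by fun_prop) (by fun_prop : Measurable _).aestronglyMeasurable]
    simp
  · rw [expScale_eq_expMixture h0 h1 hν, integral_exp_expMixture h0 h1 hs]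

/-! ### The limit law -/

/-- The law of `E ^ (1 / δ') * S * K ^ (-1 / δ)`, with `E` a standard exponential variable
independent of `(S, K)`. -/
noncomputable def mittagLefflerMixture {Ω' : Type*} [MeasurableSpace Ω'] (P' : Measure Ω')
    (δ δ' : ℝ) (S K : Ω' → ℝ) : Measure ℝ :=
  ((expMeasure 1).prod P').map (fun p => p.1 ^ δ'⁻¹ * S p.2 * K p.2 ^ (-δ⁻¹))

section mixture

variable {Ω' : Type*} [MeasurableSpace Ω'] {P' : Measure Ω'} {δ δ' : ℝ} {S K : Ω' → ℝ}

lemma mittagLefflerMixture_ae_nonneg (hSm : Measurable S) (hKm : Measurable K)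
    (hS : ∀ᵐ ω ∂P', 0 < S ω) (hK : ∀ᵐ ω ∂P', 0 < K ω) :
    ∀ᵐ x ∂mittagLefflerMixture P' δ δ' S K, 0 ≤ x := by
  rw [mittagLefflerMixture, ae_map_iff (by fun_prop) measurableSet_Ici]
  filter_upwards [Measure.quasiMeasurePreserving_fst.ae expMeasure_one_ae_pos,
    Measure.quasiMeasurePreserving_snd.ae hS, Measure.quasiMeasurePreserving_snd.ae hK]
    with p h1 h2 h3
  positivity

/-- Solving for e turns the tail event into one for the exponential variable alone, with conditional
probability exp(-x^δ' W). -/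
lemma le_rpow_mul_iff (hδ : 0 < δ) (hδ' : 0 < δ') {x e s k : ℝ} (hx : 0 ≤ x) (he : 0 < e)
    (hs : 0 < s) (hk : 0 < k) :
    x ≤ e ^ δ'⁻¹ * s * k ^ (-δ⁻¹) ↔ x ^ δ' * (s ^ (-δ') * k ^ (δ' / δ)) ≤ e := by
  have hx' : x ^ δ' * (s ^ (-δ') * k ^ (δ' / δ)) = (x * s⁻¹ * k ^ δ⁻¹) ^ δ' := by
    rw [Real.mul_rpow (by positivity) (by positivity), Real.mul_rpow hx (by positivity),
      Real.inv_rpow hs.le, Real.rpow_neg hs.le, ← Real.rpow_mul hk.le, mul_assoc]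
    congr 3
    field_simp
  rw [hx', ← Real.le_rpow_inv_iff_of_pos (by positivity) he.le hδ', Real.rpow_neg hk.le]
  have : 0 < k ^ δ⁻¹ := by positivity
  rw [← div_eq_mul_inv, le_div_iff₀ this, ← div_eq_mul_inv, div_mul_eq_mul_div, div_le_iff₀ hs]

variable [IsProbabilityMeasure P']

lemma isProbabilityMeasure_mittagLefflerMixture (hSm : Measurable S) (hKm : Measurable K) :
    IsProbabilityMeasure (mittagLefflerMixture P' δ δ' S K) :=
  Measure.isProbabilityMeasure_map (by fun_prop)

lemma measureReal_mittagLefflerMixture_Ici (hδ : 0 < δ) (hδ' : 0 < δ') (hSm : Measurable S)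
    (hKm : Measurable K) (hS : ∀ᵐ ω ∂P', 0 < S ω) (hK : ∀ᵐ ω ∂P', 0 < K ω) {x : ℝ} (hx : 0 ≤ x) :
    (mittagLefflerMixture P' δ δ' S K).real (Ici x) =
      ∫ ω, Real.exp (-(x ^ δ' * (S ω ^ (-δ') * K ω ^ (δ' / δ)))) ∂P' := by
  have hm : Measurable fun p : ℝ × Ω' => p.1 ^ δ'⁻¹ * S p.2 * K p.2 ^ (-δ⁻¹) := by fun_prop
  rw [mittagLefflerMixture, measureReal_def, Measure.map_apply hm measurableSet_Ici,
    Measure.prod_apply_symm (hm measurableSet_Ici), integral_eq_lintegral_of_nonneg_ae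
    (ae_of_all _ fun _ => (Real.exp_pos _).le)
    (by fun_prop : Measurable _).aestronglyMeasurable]
  congr 1
  refine lintegral_congr_ae ?_
  filter_upwards [hS, hK] with ω hs hk
  have hW : 0 ≤ x ^ δ' * (S ω ^ (-δ') * K ω ^ (δ' / δ)) := by positivity
  rw [← measureReal_expMeasure_one_Ici hW, ofReal_measureReal]
  refine measure_congr ?_
  filter_upwards [expMeasure_one_ae_pos] with e he
  exact propext (le_rpow_mul_iff hδ hδ' hx he hs hk)

lemma measureReal_mittagLefflerMixture_Ici_of_nonpos (hSm : Measurable S)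
    (hKm : Measurable K) (hS : ∀ᵐ ω ∂P', 0 < S ω) (hK : ∀ᵐ ω ∂P', 0 < K ω) {x : ℝ} (hx : x ≤ 0) :
    (mittagLefflerMixture P' δ δ' S K).real (Ici x) = 1 := by
  have := isProbabilityMeasure_mittagLefflerMixture (P' := P') (δ := δ) (δ' := δ') hSm hKm
  rw [measureReal_def, prob_compl_eq_zero_iff measurableSet_Ici |>.1, ENNReal.toReal_one]
  refine mem_ae_iff.1 ?_
  filter_upwards [mittagLefflerMixture_ae_nonneg hSm hKm hS hK] with y hy
  exact hx.trans hy

lemma integral_exp_mittagLefflerMixture (hδ : 0 < δ) (hδδ' : δ < δ') (hδ' : δ' ≤ 1)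
    (hSm : Measurable S) (hKm : Measurable K) (hS : IsStrictlyStable δ' 1 (P'.map S))
    (hK : P'.map K = kMeasure (δ / δ')) (hSK : IndepFun S K P') {s : ℝ} (hs : 0 ≤ s) :
    ∫ x, Real.exp (-s * x) ∂mittagLefflerMixture P' δ δ' S K = (1 + s ^ δ)⁻¹ := by
  have h0 : 0 < δ' := hδ.trans hδδ'
  have hρ0 : 0 < δ / δ' := by positivity
  have hρ1 : δ / δ' < 1 := (div_lt_one h0).2 hδδ'
  have := hS.isProbabilityMeasure
  have := isProbabilityMeasure_kMeasure hρ0 hρ1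
  have hlaw : mittagLefflerMixture P' δ δ' S K =
      ((((expMeasure 1).prod (P'.map S)).prod (kMeasure (δ / δ'))).map
        (fun p : (ℝ × ℝ) × ℝ => p.1.1 ^ δ'⁻¹ * p.1.2 * p.2 ^ (-δ⁻¹))) := by
    have h1 := (indepFun_iff_map_prod_eq_prod_map_map hSm.aemeasurable hKm.aemeasurable).1 hSK
    have h2 : ((expMeasure 1).prod P').map (Prod.map id fun ω => (S ω, K ω)) =
        (expMeasure 1).prod ((P'.map S).prod (P'.map K)) := by
      rw [← h1, ← Measure.map_prod_map _ _ measurable_id (by fun_prop), Measure.map_id]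
    have h3 := (measurePreserving_prodAssoc (expMeasure 1) (P'.map S) (P'.map K)).map_eq
    rw [← hK]
    have h4 : mittagLefflerMixture P' δ δ' S K =
        (((expMeasure 1).prod P').map (Prod.map id fun ω => (S ω, K ω))).map
          (fun q : ℝ × ℝ × ℝ => q.1 ^ δ'⁻¹ * q.2.1 * q.2.2 ^ (-δ⁻¹)) := by
      rw [Measure.map_map (by fun_prop) (by fun_prop)]
      rfl
    rw [h4, h2, ← h3, Measure.map_map (by fun_prop) (by fun_prop)]
    rfl
  rw [hlaw, integral_map (by fun_prop) (by fun_prop : Measurable _).aestronglyMeasurable,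
    integral_prod_symm]
  -- Given K = k, the inner integral is the transform 1/(1 + (s k^(-1/δ))^δ') of E^(1/δ') S. The
  -- Stieltjes transform at u = s^δ' then integrates out k.
  · have hu : (0 : ℝ) ≤ s ^ δ' := by positivity
    have hst := integral_kMeasure_stieltjes_real hρ0 hρ1 hu
    rw [← Real.rpow_mul hs, mul_div_cancel₀ _ h0.ne'] at hst
    rw [← hst]
    refine integral_congr_ae ?_
    filter_upwards [kMeasure_ae_pos (δ / δ')] with k hk
    have hk' : 0 ≤ s * k ^ (-δ⁻¹) := by positivity
    have := hS.integral_exp_expScale h0 hδ' hk'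
    rw [expScale, integral_map (by fun_prop) (by fun_prop : Measurable _).aestronglyMeasurable,
      Real.mul_rpow hs (by positivity), ← Real.rpow_mul hk.le] at this
    rw [show -(δ / δ')⁻¹ = -δ⁻¹ * δ' by field_simp, ← this]
    congr 1
    ext p
    congr 1
    ring
  · refine Integrable.of_bound (by fun_prop : Measurable _).aestronglyMeasurable 1 ?_
    filter_upwards [Measure.quasiMeasurePreserving_snd.ae (kMeasure_ae_pos (δ / δ')),
      Measure.quasiMeasurePreserving_fst.ae
        (Measure.quasiMeasurePreserving_fst.ae expMeasure_one_ae_pos),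
      Measure.quasiMeasurePreserving_fst.ae
        (Measure.quasiMeasurePreserving_snd.ae (hS.ae_pos h0 hδ'))] with p hp1 hp2 hp3
    rw [Real.norm_of_nonneg (Real.exp_pos _).le, Real.exp_le_one_iff, neg_mul, neg_nonpos]
    positivity

lemma isMittagLeffler_mittagLefflerMixture (hδ : 0 < δ) (hδδ' : δ < δ') (hδ' : δ' ≤ 1)
    (hSm : Measurable S) (hKm : Measurable K) (hS : IsStrictlyStable δ' 1 (P'.map S))
    (hK : P'.map K = kMeasure (δ / δ')) (hSK : IndepFun S K P') :
    IsMittagLeffler δ (mittagLefflerMixture P' δ δ' S K) where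
  isProbabilityMeasure := isProbabilityMeasure_mittagLefflerMixture hSm hKm
  nonneg := mittagLefflerMixture_ae_nonneg hSm hKm
    (ae_of_ae_map hSm.aemeasurable (hS.ae_pos (hδ.trans hδδ') hδ'))
    (ae_of_ae_map hKm.aemeasurable (hK ▸ kMeasure_ae_pos _))
  laplace s hs := by
    rw [integral_exp_mittagLefflerMixture hδ hδδ' hδ' hSm hKm hS hK hSK hs, one_div]

end mixture

/-! ### Weak convergence from convergence of tails -/

/-- Half-open intervals form a π-system containing arbitrarily small neighbourhoods of each point,
and their masses are differences of tails. -/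
lemma tendsto_probabilityMeasure_of_tendsto_Ici {μ : ℕ → ProbabilityMeasure ℝ}
    {ν : ProbabilityMeasure ℝ}
    (h : ∀ x, Tendsto (fun k => (μ k : Measure ℝ).real (Ici x)) atTop
      (𝓝 ((ν : Measure ℝ).real (Ici x)))) :
    Tendsto μ atTop (𝓝 ν) := by
  have hIco : ∀ (ρ : ProbabilityMeasure ℝ) {a b : ℝ}, a ≤ b →
      (ρ (Ico a b) : ℝ) = (ρ : Measure ℝ).real (Ici a) - (ρ : Measure ℝ).real (Ici b) := by
    intro ρ a b hab
    rw [← Ici_sdiff_Ici, ProbabilityMeasure.coeFn_def]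
    exact measureReal_sdiff (Ici_subset_Ici.2 hab) measurableSet_Ici
  refine (isPiSystem_Ico_mem (univ : Set ℝ) univ).tendsto_probabilityMeasure_of_tendsto_of_mem
    ?_ ?_ ?_
  · rintro s ⟨a, -, b, -, hab, rfl⟩
    exact measurableSet_Ico
  · intro u hu x hx
    obtain ⟨ε, hε, hsub⟩ := Metric.isOpen_iff.1 hu x hx
    refine ⟨Ico (x - ε / 2) (x + ε / 2),
      ⟨x - ε / 2, mem_univ _, x + ε / 2, mem_univ _, by linarith, rfl⟩,
      Ico_mem_nhds (by linarith) (by linarith), fun y hy => hsub ?_⟩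
    rw [Metric.mem_ball, Real.dist_eq, abs_lt]
    constructor <;> linarith [hy.1, hy.2]
  · rintro s ⟨a, -, b, -, hab, rfl⟩
    rw [← NNReal.tendsto_coe]
    simp only [hIco _ hab.le]
    exact (h a).sub (h b)

/-! ### The Poisson process at an independent random time -/

/-- The least multiple of `1 / (n + 1)` strictly above `u`. -/
noncomputable def upApprox (n : ℕ) (u : ℝ≥0) : ℝ≥0 := (⌊(n + 1) * u⌋₊ + 1) / (n + 1)

lemma lt_upApprox (n : ℕ) (u : ℝ≥0) : u < upApprox n u := by
  rw [upApprox, lt_div_iff₀ (by positivity), mul_comm]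
  exact Nat.lt_floor_add_one _

lemma upApprox_le (n : ℕ) (u : ℝ≥0) : upApprox n u ≤ u + 1 / (n + 1) := by
  have : (⌊(n + 1) * u⌋₊ : ℝ≥0) ≤ (n + 1) * u := Nat.floor_le (by positivity)
  rw [upApprox, add_div]
  gcongr
  rwa [div_le_iff₀ (by positivity), mul_comm u]

lemma tendsto_upApprox (u : ℝ≥0) : Tendsto (fun n => upApprox n u) atTop (𝓝 u) := by
  refine tendsto_of_tendsto_of_tendsto_of_le_of_le tendsto_const_nhds ?_
    (fun n => (lt_upApprox n u).le) (fun n => upApprox_le n u)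
  have h := (NNReal.tendsto_coe.1 (by
    push_cast
    exact tendsto_one_div_add_atTop_nhds_zero_nat (𝕜 := ℝ)) :
      Tendsto (fun n : ℕ => (1 / (n + 1) : ℝ≥0)) atTop (𝓝 0))
  simpa using h.const_add u

/-- The discretised time takes countably many values, so measurability of each coordinate suffices.
This applies even to the coordinate process on the full product space, where evaluation at a general
random time need not be measurable. -/
lemma measurable_eval_upApprox {β : Type*} [MeasurableSpace β] {Q : ℝ≥0 → β → ℕ}
    (hQ : ∀ t, Measurable (Q t)) (n : ℕ) :
    Measurable (fun p : ℝ≥0 × β => Q (upApprox n p.1) p.2) := by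
  have h : Measurable (fun p : ℕ × β => Q ((p.1 + 1) / (n + 1)) p.2) :=
    by
    refine measurable_from_prod_countable_right fun j => ?_
    exact hQ ((j + 1) / (n + 1))
  have h' : Measurable (fun p : ℝ≥0 × β => (⌊((n : ℝ≥0) + 1) * p.1⌋₊, p.2)) :=
    (Nat.measurable_floor.comp (measurable_fst.const_mul _)).prodMk measurable_snd
  simpa only [Function.comp_def, upApprox] using h.comp h'

lemma integral_pow_poissonMeasure (r : ℝ≥0) (z : ℝ) :
    ∫ j, z ^ j ∂poissonMeasure r = Real.exp (-(1 - z) * r) := by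
  rw [integral_poissonMeasure]
  have h := (NormedSpace.expSeries_div_hasSum_exp (r * z : ℝ)).mul_left (Real.exp (-r))
  rw [← Real.exp_eq_exp_ℝ, ← Real.exp_add] at h
  rw [show -(1 - z) * r = -r + r * z by ring, ← h.tsum_eq]
  congr 1
  ext j
  rw [smul_eq_mul, mul_pow]
  ring

section Poisson

variable {Ω : Type*} [MeasurableSpace Ω] {P : Measure Ω} {Q : ℝ≥0 → Ω → ℕ}

lemma IsUnitPoissonProcess.tendsto_upApprox (hQ : IsUnitPoissonProcess Q P) (u : ℝ≥0) (ω : Ω) :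
    Tendsto (fun n => Q (upApprox n u) ω) atTop (𝓝 (Q u ω)) :=
  (hQ.rightCont ω u).tendsto.comp (tendsto_nhdsWithin_iff.2
    ⟨_root_.tendsto_upApprox u, Eventually.of_forall fun n => (lt_upApprox n u).le⟩)

lemma IsUnitPoissonProcess.measurable_comp (hQ : IsUnitPoissonProcess Q P) {U : Ω → ℝ≥0}
    (hU : Measurable U) : Measurable (fun ω => Q (U ω) ω) :=
  measurable_of_tendsto_metrizable
    (fun n => (measurable_eval_upApprox hQ.measurable n).comp (hU.prodMk measurable_id))
    (tendsto_pi_nhds.2 fun ω => hQ.tendsto_upApprox (U ω) ω)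

lemma IsUnitPoissonProcess.integral_pow (hQ : IsUnitPoissonProcess Q P) (t : ℝ≥0) (z : ℝ) :
    ∫ ω, z ^ Q t ω ∂P = Real.exp (-(1 - z) * t) := by
  have h := hQ.increment_law 0 t zero_le
  simp only [hQ.zero, tsub_zero] at h
  rw [← integral_pow_poissonMeasure, ← h, integral_map (hQ.measurable t).aemeasurable
    (by fun_prop : Measurable _).aestronglyMeasurable]

variable [IsProbabilityMeasure P]

/-- Independence factorises the joint law of U and the whole path, and Fubini applies on the path
space because the time is discretised. Right-continuity removes the discretisation afterwards. -/
lemma IsUnitPoissonProcess.integral_pow_upApprox (hQ : IsUnitPoissonProcess Q P) {U : Ω → ℝ≥0}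
    (hU : Measurable U) (hUQ : IndepFun U (fun ω t => Q t ω) P) {z : ℝ} (hz : z ∈ Icc (0 : ℝ) 1)
    (n : ℕ) :
    ∫ ω, z ^ Q (upApprox n (U ω)) ω ∂P = ∫ ω, Real.exp (-(1 - z) * upApprox n (U ω)) ∂P := by
  have hQm : Measurable (fun ω t => Q t ω) := measurable_pi_lambda _ hQ.measurable
  have hlaw := (indepFun_iff_map_prod_eq_prod_map_map hU.aemeasurable hQm.aemeasurable).1 hUQ
  have := Measure.isProbabilityMeasure_map (μ := P) hU.aemeasurable
  have := Measure.isProbabilityMeasure_map (μ := P) hQm.aemeasurable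
  have he : Measurable (fun p : ℝ≥0 × (ℝ≥0 → ℕ) => p.2 (upApprox n p.1)) :=
    measurable_eval_upApprox (Q := fun t (q : ℝ≥0 → ℕ) => q t) (fun t => measurable_pi_apply t) n
  have hzm : Measurable (fun j : ℕ => z ^ j) := measurable_of_countable _
  have hf : Measurable (fun p : ℝ≥0 × (ℝ≥0 → ℕ) => z ^ p.2 (upApprox n p.1)) := hzm.comp he
  have h1 : ∫ ω, z ^ Q (upApprox n (U ω)) ω ∂P =
      ∫ p, z ^ p.2 (upApprox n p.1) ∂(P.map fun ω => (U ω, fun t => Q t ω)) := by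
    rw [integral_map (hU.prodMk hQm).aemeasurable hf.aestronglyMeasurable]
  have hap : Measurable (upApprox n) := by
    unfold upApprox
    fun_prop
  rw [h1, hlaw, integral_prod, integral_map hU.aemeasurable]
  · congr 1
    ext ω
    have hs : Measurable fun q : ℝ≥0 → ℕ => z ^ q (upApprox n (U ω)) :=
      hf.comp measurable_prodMk_left
    rw [integral_map hQm.aemeasurable hs.aestronglyMeasurable, hQ.integral_pow]
  · exact hf.stronglyMeasurable.integral_prod_right'.aestronglyMeasurable
  · refine Integrable.of_bound hf.aestronglyMeasurable 1 (ae_of_all _ fun p => ?_)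
    rw [Real.norm_of_nonneg (pow_nonneg hz.1 _)]
    exact pow_le_one₀ hz.1 hz.2

/-- The generating function of a mixed Poisson random variable. -/
lemma IsUnitPoissonProcess.integral_pow_comp (hQ : IsUnitPoissonProcess Q P) {U : Ω → ℝ≥0}
    (hU : Measurable U) (hUQ : IndepFun U (fun ω t => Q t ω) P) {z : ℝ}
    (hz : z ∈ Icc (0 : ℝ) 1) :
    ∫ ω, z ^ Q (U ω) ω ∂P = ∫ ω, Real.exp (-(1 - z) * U ω) ∂P := by
  have hzm : Measurable (fun j : ℕ => z ^ j) := measurable_of_countable _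
  have hap : ∀ n, Measurable (upApprox n) := fun n => by
    unfold upApprox
    fun_prop
  have l1 : Tendsto (fun n => ∫ ω, z ^ Q (upApprox n (U ω)) ω ∂P) atTop
      (𝓝 (∫ ω, z ^ Q (U ω) ω ∂P)) := by
    refine tendsto_integral_of_dominated_convergence (fun _ => 1) (fun n => ?_)
      (integrable_const _) (fun n => ae_of_all _ fun ω => ?_) (ae_of_all _ fun ω => ?_)
    · exact (hzm.comp ((measurable_eval_upApprox hQ.measurable n).comp
        (hU.prodMk measurable_id))).aestronglyMeasurable
    · rw [Real.norm_of_nonneg (pow_nonneg hz.1 _)]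
      exact pow_le_one₀ hz.1 hz.2
    · exact (continuous_of_discreteTopology (f := fun j : ℕ => z ^ j)).continuousAt.tendsto.comp
        (hQ.tendsto_upApprox (U ω) ω)
  have l2 : Tendsto (fun n => ∫ ω, Real.exp (-(1 - z) * upApprox n (U ω)) ∂P) atTop
      (𝓝 (∫ ω, Real.exp (-(1 - z) * U ω) ∂P)) := by
    refine tendsto_integral_of_dominated_convergence (fun _ => 1) (fun n => ?_)
      (integrable_const _) (fun n => ae_of_all _ fun ω => ?_) (ae_of_all _ fun ω => ?_)
    · have := hap n
      exact (by fun_prop : Measurable _).aestronglyMeasurable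
    · rw [Real.norm_of_nonneg (Real.exp_pos _).le, Real.exp_le_one_iff, neg_mul, neg_nonpos]
      exact mul_nonneg (by linarith [hz.2]) (upApprox n (U ω)).2
    · have := (NNReal.tendsto_coe.2 (_root_.tendsto_upApprox (U ω))).const_mul (-(1 - z))
      exact (Real.continuous_exp.tendsto _).comp this
  simp only [hQ.integral_pow_upApprox hU hUQ hz] at l1
  exact tendsto_nhds_unique l1 l2

end Poisson

/-! ### Minima of samples of random size -/

section sampleMin

variable {Ω : Type*} [MeasurableSpace Ω] {P : Measure Ω}

lemma le_sampleMin_iff {c : ℝ} {x : ℕ → ℝ} {n : ℕ} (hn : n ≠ 0) (y : ℝ) :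
    y ≤ sampleMin c x n ↔ ∀ j < n, y ≤ x j := by
  rw [sampleMin, dif_pos (Finset.nonempty_range_iff.2 hn), Finset.le_inf'_iff]
  simp

lemma measurable_sampleMin (c : ℝ) :
    Measurable (fun p : ℕ × (ℕ → ℝ) => sampleMin c p.2 p.1) := by
  refine measurable_from_prod_countable_right fun n => ?_
  rcases eq_or_ne n 0 with rfl | hn
  · simp only [sampleMin, Finset.range_zero, Finset.not_nonempty_empty]
    exact measurable_const
  · refine measurable_of_Ici fun y => ?_
    have : (fun x : ℕ → ℝ => sampleMin c x n) ⁻¹' Ici y =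
        ⋂ j : ℕ, ⋂ _ : j < n, (fun x : ℕ → ℝ => x j) ⁻¹' Ici y := by
      ext x
      simp [le_sampleMin_iff hn]
    rw [this]
    exact MeasurableSet.iInter fun j => MeasurableSet.iInter fun _ =>
      measurable_pi_apply j measurableSet_Ici

variable [IsProbabilityMeasure P] {X : ℕ → Ω → ℝ} {F : ℝ → ℝ} {N : Ω → ℕ}

lemma measureReal_forall_lt_le (hX : ∀ i, Measurable (X i)) (hXind : iIndepFun X P)
    (hF : ∀ i x, F x = P.real {ω | X i ω < x}) (n : ℕ) (y : ℝ) :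
    P.real {ω | ∀ j < n, y ≤ X j ω} = (1 - F y) ^ n := by
  have h := hXind.measure_inter_preimage_eq_mul (Finset.range n) (sets := fun _ => Ici y)
    (fun i _ => measurableSet_Ici)
  have hset : {ω | ∀ j < n, y ≤ X j ω} = ⋂ i ∈ Finset.range n, X i ⁻¹' Ici y := by
    ext ω
    simp
  have h1 : ∀ i, P.real (X i ⁻¹' Ici y) = 1 - F y := by
    intro i
    rw [hF i, ← probReal_compl_eq_one_sub (measurableSet_lt (hX i) measurable_const)]
    congr 1
    ext ω
    simp
  rw [hset, measureReal_def, h, ENNReal.toReal_prod]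
  simp_rw [← measureReal_def, h1]
  simp

lemma measureReal_forall_lt_random_le (hX : ∀ i, Measurable (X i)) (hXind : iIndepFun X P)
    (hF : ∀ i x, F x = P.real {ω | X i ω < x}) (hN : Measurable N)
    (hNX : IndepFun N (fun ω i => X i ω) P) (y : ℝ) :
    P.real {ω | ∀ j < N ω, y ≤ X j ω} = ∫ ω, (1 - F y) ^ N ω ∂P := by
  have hXm : Measurable (fun ω i => X i ω) := measurable_pi_lambda _ hX
  have hlaw := (indepFun_iff_map_prod_eq_prod_map_map hN.aemeasurable hXm.aemeasurable).1 hNX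
  have := Measure.isProbabilityMeasure_map (μ := P) hN.aemeasurable
  have := Measure.isProbabilityMeasure_map (μ := P) hXm.aemeasurable
  have hA : MeasurableSet {p : ℕ × (ℕ → ℝ) | ∀ j < p.1, y ≤ p.2 j} := by
    have : {p : ℕ × (ℕ → ℝ) | ∀ j < p.1, y ≤ p.2 j} =
        ⋂ j : ℕ, ({p | p.1 ≤ j} ∪ {p | y ≤ p.2 j}) := by
      ext p
      simp only [mem_ofPred_eq, mem_iInter, mem_union]
      exact forall_congr' fun j => by rw [imp_iff_not_or, not_lt]
    rw [this]
    exact MeasurableSet.iInter fun j => (measurableSet_le measurable_fst measurable_const).union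
      (measurableSet_le measurable_const ((measurable_pi_apply j).comp measurable_snd))
  have h1 : P {ω | ∀ j < N ω, y ≤ X j ω} =
      (P.map fun ω => (N ω, fun i => X i ω)) {p | ∀ j < p.1, y ≤ p.2 j} := by
    rw [Measure.map_apply (hN.prodMk hXm) hA]
    rfl
  have hF0 : 0 ≤ 1 - F y := by
    rw [hF 0]
    linarith [measureReal_le_one (μ := P) (s := {ω | X 0 ω < y})]
  rw [measureReal_def, h1, hlaw, Measure.prod_apply hA,
    lintegral_map (measurable_measure_prodMk_left hA) hN,
    integral_eq_lintegral_of_nonneg_ae (ae_of_all _ fun ω => pow_nonneg hF0 _)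
    ((measurable_of_countable (fun j : ℕ => (1 - F y) ^ j)).comp hN).aestronglyMeasurable]
  congr 1
  refine lintegral_congr fun ω => ?_
  rw [Measure.map_apply hXm (measurable_prodMk_left hA),
    ← measureReal_forall_lt_le hX hXind hF (N ω) y, ofReal_measureReal]
  rfl

/-- The tail of the minimum of a sample of random size, up to the probability of an empty sample. -/
lemma abs_measureReal_le_sampleMin_sub_le (hX : ∀ i, Measurable (X i)) (hXind : iIndepFun X P)
    (hF : ∀ i x, F x = P.real {ω | X i ω < x}) (hN : Measurable N)
    (hNX : IndepFun N (fun ω i => X i ω) P) (c y : ℝ) :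
    |P.real {ω | y ≤ sampleMin c (fun j => X j ω) (N ω)} - ∫ ω, (1 - F y) ^ N ω ∂P| ≤
      ∫ ω, (0 : ℝ) ^ N ω ∂P := by
  -- Here 0 ^ 0 = 1, so the integrand is the indicator of an empty sample.
  have h0 : ∫ ω, (0 : ℝ) ^ N ω ∂P = P.real {ω | N ω = 0} := by
    have hm : MeasurableSet {ω | N ω = 0} := hN (measurableSet_singleton 0)
    rw [← integral_indicator_one hm]
    congr 1
    ext ω
    by_cases h : N ω = 0 <;> simp [h]
  -- For a nonempty sample the two events coincide; the default value c matters only when N = 0.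
  rw [h0, ← measureReal_forall_lt_random_le hX hXind hF hN hNX, abs_sub_le_iff]
  constructor
  · rw [sub_le_iff_le_add]
    refine le_trans (measureReal_mono ?_) (measureReal_union_le _ _)
    intro ω hω
    by_cases h : N ω = 0
    · exact Or.inl h
    · exact Or.inr ((le_sampleMin_iff h y).1 hω)
  · rw [sub_le_iff_le_add]
    refine le_trans (measureReal_mono ?_) (measureReal_union_le _ _)
    intro ω hω
    by_cases h : N ω = 0
    · exact Or.inl h
    · exact Or.inr ((le_sampleMin_iff h y).2 hω)

end sampleMin

/-! ### Regular variation at the left endpoint and the norming constants -/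

section regularVariation

variable {F : ℝ → ℝ} {γ : ℝ}

lemma MinDomainWeibull.tendsto_div (h : MinDomainWeibull F γ) {r : ℝ} (hr : 0 < r) :
    Tendsto (fun t => F (lext F + r * t) / F (lext F + t)) (𝓝[>] 0) (𝓝 (r ^ γ)) := by
  have h1 := (h.regular r⁻¹ (by positivity)).comp
    (tendsto_neg_atTop_atBot.comp (tendsto_inv_nhdsGT_zero (𝕜 := ℝ)))
  rw [Real.inv_rpow hr.le, Real.rpow_neg hr.le, inv_inv] at h1
  refine h1.congr' ?_
  filter_upwards [self_mem_nhdsWithin] with t ht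
  have ht' : t ≠ 0 := (mem_Ioi.1 ht).ne'
  simp only [Function.comp]
  congr 2
  · field_simp
    ring
  · field_simp
    ring

lemma pos_of_lext_lt (hmono : Monotone F) (hne : ∃ x, 0 < F x) {x : ℝ} (hx : lext F < x) :
    0 < F x := by
  obtain ⟨z, hz, hzx⟩ := exists_lt_of_csInf_lt hne hx
  exact lt_of_lt_of_le hz (hmono hzx.le)

/-- A positive right limit at the endpoint would force F(lext F + 2t) / F(lext F + t) → 1, whereas
regular variation gives 2^γ > 1. So F has no atom at its left endpoint. -/
lemma MinDomainWeibull.tendsto_zero (h : MinDomainWeibull F γ) (hγ : 0 < γ) (hmono : Monotone F)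
    (h0 : ∀ x, 0 ≤ F x) :
    Tendsto (fun t => F (lext F + t)) (𝓝[>] 0) (𝓝 0) := by
  have hm : Monotone fun t => F (lext F + t) := fun a b hab => hmono (by linarith)
  have h1 := hm.tendsto_nhdsGT 0
  set p := sInf ((fun t => F (lext F + t)) '' Ioi 0) with hp
  have hp0 : 0 ≤ p := Real.sInf_nonneg (by rintro _ ⟨t, -, rfl⟩; exact h0 _)
  rcases hp0.eq_or_lt with hp0 | hp0
  · rwa [← hp0] at h1
  · have hscale : Tendsto (fun t : ℝ => 2 * t) (𝓝[>] 0) (𝓝[>] 0) := by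
      refine tendsto_nhdsWithin_iff.2 ⟨?_, ?_⟩
      · have : Tendsto (fun t : ℝ => 2 * t) (𝓝 0) (𝓝 (2 * 0)) := tendsto_id.const_mul 2
        rw [mul_zero] at this
        exact this.mono_left nhdsWithin_le_nhds
      · filter_upwards [self_mem_nhdsWithin] with t ht
        simpa using ht
    have h2 := (h1.comp hscale).div h1 hp0.ne'
    rw [div_self hp0.ne'] at h2
    have h3 := tendsto_nhds_unique h2 (h.tendsto_div (r := 2) two_pos)
    have := Real.one_lt_rpow (x := 2) (by norm_num) hγ
    linarith

lemma MinDomainWeibull.eq_zero_of_le (h : MinDomainWeibull F γ) (hγ : 0 < γ) (hmono : Monotone F)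
    (h0 : ∀ x, 0 ≤ F x) {x : ℝ} (hx : x ≤ lext F) : F x = 0 := by
  refine le_antisymm (ge_of_tendsto (h.tendsto_zero hγ hmono h0) ?_) (h0 x)
  filter_upwards [self_mem_nhdsWithin] with t ht
  exact hmono (by linarith [mem_Ioi.1 ht])

lemma bddAbove_setOf_le (hmono : Monotone F) {q : ℝ} (h : ∃ x, q < F x) :
    BddAbove {x | F x ≤ q} := by
  obtain ⟨M, hM⟩ := h
  refine ⟨M, fun x hx => ?_⟩
  by_contra! hlt
  exact absurd (hmono hlt.le) (not_le.2 (lt_of_le_of_lt hx hM))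

lemma MinDomainWeibull.lext_lt_sSup (h : MinDomainWeibull F γ) (hγ : 0 < γ) (hmono : Monotone F)
    (h0 : ∀ x, 0 ≤ F x) {q : ℝ} (hq : 0 < q) (hq1 : ∃ x, q < F x) :
    lext F < sSup {x | F x ≤ q} := by
  obtain ⟨t, ht, ht0⟩ := (((h.tendsto_zero hγ hmono h0).eventually (gt_mem_nhds hq)).and
    self_mem_nhdsWithin).exists
  have : lext F + t ≤ sSup {x | F x ≤ q} := le_csSup (bddAbove_setOf_le hmono hq1) ht.le
  linarith [show 0 < t from ht0]

lemma le_of_lt_sSup (hmono : Monotone F) {q x : ℝ} (hne : {x | F x ≤ q}.Nonempty)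
    (hx : x < sSup {x | F x ≤ q}) : F x ≤ q := by
  obtain ⟨z, hz, hxz⟩ := exists_lt_of_lt_csSup hne hx
  exact (hmono hxz.le).trans hz

lemma lt_of_sSup_lt {q x : ℝ} (hb : BddAbove {x | F x ≤ q})
    (hx : sSup {x | F x ≤ q} < x) : q < F x := by
  by_contra! hle
  exact absurd (le_csSup hb hle) (not_le.2 hx)

/-- The norming constants for the minima: `sup {x : F x ≤ 1 / d} - lext F` (and `1` if `d ≤ 1`). -/
noncomputable def minScale (F : ℝ → ℝ) (d : ℝ) : ℝ :=
  if 1 < d then sSup {x | F x ≤ d⁻¹} - lext F else 1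

lemma MinDomainWeibull.minScale_pos (h : MinDomainWeibull F γ) (hγ : 0 < γ) (hmono : Monotone F)
    (h0 : ∀ x, 0 ≤ F x) (h1 : ∀ q < 1, ∃ x, q < F x) (d : ℝ) : 0 < minScale F d := by
  unfold minScale
  split_ifs with hd
  · exact sub_pos.2 (h.lext_lt_sSup hγ hmono h0 (by positivity)
      (h1 _ (inv_lt_one_of_one_lt₀ hd)))
  · exact one_pos

lemma MinDomainWeibull.tendsto_minScale (h : MinDomainWeibull F γ) (hγ : 0 < γ)
    (hmono : Monotone F) (h0 : ∀ x, 0 ≤ F x) (h1 : ∀ q < 1, ∃ x, q < F x) :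
    Tendsto (minScale F) atTop (𝓝[>] 0) := by
  refine tendsto_nhdsWithin_iff.2 ⟨?_, Eventually.of_forall (h.minScale_pos hγ hmono h0 h1)⟩
  refine tendsto_order.2 ⟨fun a ha => Eventually.of_forall fun d =>
    ha.trans (h.minScale_pos hγ hmono h0 h1 d), fun a ha => ?_⟩
  have hpos : 0 < F (lext F + a / 2) :=
    pos_of_lext_lt hmono (h1 0 one_pos) (by linarith)
  filter_upwards [eventually_gt_atTop 1,
    (tendsto_inv_atTop_zero (𝕜 := ℝ)).eventually (gt_mem_nhds hpos)] with d hd hd'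
  have hne : {x | F x ≤ d⁻¹}.Nonempty := ⟨lext F, by
    rw [mem_ofPred_eq, h.eq_zero_of_le hγ hmono h0 le_rfl]
    positivity⟩
  have : sSup {x | F x ≤ d⁻¹} ≤ lext F + a / 2 := csSup_le hne fun x hx => by
    by_contra! hlt
    exact absurd (hmono hlt.le) (not_le.2 (lt_of_le_of_lt hx hd'))
  rw [minScale, if_pos hd]
  linarith

/-- F need not attain the value 1/d, so 1/d is trapped between values of F at lext F + r b for r on
either side of 1. Regular variation controls the ratios, and continuity of (x/r)^γ at r = 1 closes
the gap. -/
lemma MinDomainWeibull.tendsto_mul (h : MinDomainWeibull F γ) (hγ : 0 < γ)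
    (hmono : Monotone F) (h0 : ∀ x, 0 ≤ F x) (h1 : ∀ q < 1, ∃ x, q < F x) {x : ℝ} (hx : 0 < x) :
    Tendsto (fun d => d * F (lext F + minScale F d * x)) atTop (𝓝 (x ^ γ)) := by
  have hb := h.tendsto_minScale hγ hmono h0 h1
  have hratio : ∀ r : ℝ, 0 < r → Tendsto (fun d => F (lext F + minScale F d * x) /
      F (lext F + r * minScale F d)) atTop (𝓝 ((x / r) ^ γ)) := by
    intro r hr
    have hr' : Tendsto (fun d => r * minScale F d) atTop (𝓝[>] 0) := by
      have hb' := tendsto_nhdsWithin_iff.1 hb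
      refine tendsto_nhdsWithin_iff.2 ⟨by simpa using hb'.1.const_mul r, ?_⟩
      filter_upwards [hb'.2] with d hd
      exact mul_pos hr hd
    refine ((h.tendsto_div (div_pos hx hr)).comp hr').congr fun d => ?_
    simp only [Function.comp]
    congr 3
    field_simp
  have hcont : Tendsto (fun r : ℝ => (x / r) ^ γ) (𝓝 1) (𝓝 (x ^ γ)) := by
    have : ContinuousAt (fun r : ℝ => (x / r) ^ γ) 1 :=
      (continuousAt_const.div continuousAt_id one_ne_zero).rpow_const (Or.inr hγ.le)
    simpa [ContinuousAt] using this
  have hFpos : ∀ r d, 0 < r → 0 < F (lext F + r * minScale F d) := fun r d hr =>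
    pos_of_lext_lt hmono (h1 0 one_pos) (by
      linarith [mul_pos hr (h.minScale_pos hγ hmono h0 h1 d)])
  have hne : ∀ d : ℝ, 1 < d → {x | F x ≤ d⁻¹}.Nonempty := fun d hd => ⟨lext F, by
    rw [mem_ofPred_eq, h.eq_zero_of_le hγ hmono h0 le_rfl]
    positivity⟩
  refine tendsto_order.2 ⟨fun a ha => ?_, fun a ha => ?_⟩
  -- For r > 1 the point lies beyond the supremum, so F there exceeds 1/d and the ratio is a lower
  -- bound for d F(lext F + b x).
  · obtain ⟨r, hr, hr1⟩ := (((hcont.mono_left nhdsWithin_le_nhds).eventually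
      (lt_mem_nhds ha)).and (self_mem_nhdsWithin (a := (1 : ℝ)) (s := Ioi 1))).exists
    have hr0 : 0 < r := one_pos.trans hr1
    filter_upwards [(hratio r hr0).eventually (lt_mem_nhds hr), eventually_gt_atTop 1] with d hd hd1
    have hB := h.minScale_pos hγ hmono h0 h1 d
    have hlt : d⁻¹ < F (lext F + r * minScale F d) := by
      refine lt_of_sSup_lt (bddAbove_setOf_le hmono (h1 _ (inv_lt_one_of_one_lt₀ hd1))) ?_
      have : minScale F d = sSup {x | F x ≤ d⁻¹} - lext F := by rw [minScale, if_pos hd1]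
      have h2 : minScale F d < r * minScale F d := lt_mul_of_one_lt_left hB hr1
      linarith
    refine hd.trans_le ?_
    rw [div_le_iff₀ (hFpos r d hr0)]
    have h3 : 1 ≤ d * F (lext F + r * minScale F d) := by
      have hd0 : 0 < d := one_pos.trans hd1
      have := mul_lt_mul_of_pos_left hlt hd0
      rw [mul_inv_cancel₀ hd0.ne'] at this
      exact this.le
    nlinarith [h0 (lext F + minScale F d * x)]
  -- For 0 < r < 1 the point lies below the supremum, so F there is at most 1/d and the ratio is an
  -- upper bound.
  · obtain ⟨r, ⟨hr, hr1⟩, hr0⟩ := (((hcont.mono_left nhdsWithin_le_nhds).eventually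
      (gt_mem_nhds ha)).and (self_mem_nhdsWithin (a := (1 : ℝ)) (s := Iio 1))).and
        (nhdsWithin_le_nhds (lt_mem_nhds one_pos)) |>.exists
    filter_upwards [(hratio r hr0).eventually (gt_mem_nhds hr), eventually_gt_atTop 1] with d hd hd1
    have hB := h.minScale_pos hγ hmono h0 h1 d
    have hle : F (lext F + r * minScale F d) ≤ d⁻¹ := by
      refine le_of_lt_sSup hmono (hne d hd1) ?_
      have : minScale F d = sSup {x | F x ≤ d⁻¹} - lext F := by rw [minScale, if_pos hd1]
      have h2 : r * minScale F d < minScale F d := mul_lt_of_lt_one_left hB hr1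
      linarith
    refine lt_of_le_of_lt ?_ hd
    rw [le_div_iff₀ (hFpos r d hr0)]
    have h3 : d * F (lext F + r * minScale F d) ≤ 1 := by
      have hd0 : 0 < d := one_pos.trans hd1
      have := mul_le_mul_of_nonneg_left hle hd0.le
      rwa [mul_inv_cancel₀ hd0.ne'] at this
    nlinarith [h0 (lext F + minScale F d * x)]

end regularVariation

/-! ### Laplace transforms under convergence in distribution -/

section

variable {Ω : Type*} [MeasurableSpace Ω] {P : Measure Ω} [IsProbabilityMeasure P]
  {Ω' : Type*} [MeasurableSpace Ω'] {P' : Measure Ω'} [IsProbabilityMeasure P']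

/-- Convergence of Laplace transforms at a convergent sequence of arguments. -/
lemma tendsto_integral_exp_mul_of_tendstoInDistribution {V : ℕ → Ω → ℝ} {W : Ω' → ℝ}
    (h : TendstoInDistribution V atTop W (fun _ => P) P') (hV : ∀ k ω, 0 ≤ V k ω)
    (hW : ∀ᵐ ω ∂P', 0 ≤ W ω) {c : ℕ → ℝ} {c₀ : ℝ} (hc : Tendsto c atTop (𝓝 c₀))
    (hc0 : ∀ k, 0 ≤ c k) :
    Tendsto (fun k => ∫ ω, Real.exp (-(c k * V k ω)) ∂P) atTop
      (𝓝 (∫ ω, Real.exp (-(c₀ * W ω)) ∂P')) := by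
  have hc₀ : 0 ≤ c₀ := ge_of_tendsto' hc hc0
  have hm : TendstoInMeasure P (fun k (_ : Ω) => c k) atTop (fun _ => c₀) :=
    tendstoInMeasure_of_tendsto_ae (fun _ => aestronglyMeasurable_const) (ae_of_all _ fun _ => hc)
  -- Slutsky's theorem: c_k V_k converges in distribution to c₀ W.
  have h1 := h.continuous_comp_prodMk_of_tendstoInMeasure_const
    (g := fun p : ℝ × ℝ => p.2 * p.1) (by fun_prop) hm (fun _ => aemeasurable_const)
  -- Truncation at zero makes the exponential a bounded test function on the line without changing
  -- it on the nonnegative values involved.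
  let f : BoundedContinuousFunction ℝ ℝ := BoundedContinuousFunction.ofNormedAddCommGroup
    (fun x => Real.exp (-(max x 0))) (by fun_prop) 1 (fun x => by
      rw [Real.norm_of_nonneg (Real.exp_pos _).le, Real.exp_le_one_iff]
      simp)
  have h2 := ProbabilityMeasure.tendsto_iff_forall_integral_tendsto.1 h1.tendsto f
  have hfm : ∀ μ : Measure ℝ, AEStronglyMeasurable f μ := fun μ =>
    f.continuous.aestronglyMeasurable
  have e1 : ∀ k, ∫ x, f x ∂(P.map fun ω => c k * V k ω) = ∫ ω, Real.exp (-(c k * V k ω)) ∂P := by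
    intro k
    rw [integral_map (h1.forall_aemeasurable k) (hfm _)]
    congr 1
    ext ω
    change Real.exp (-(max (c k * V k ω) 0)) = _
    rw [max_eq_left (mul_nonneg (hc0 k) (hV k ω))]
  have e2 : ∫ x, f x ∂(P'.map fun ω => c₀ * W ω) = ∫ ω, Real.exp (-(c₀ * W ω)) ∂P' := by
    rw [integral_map h1.aemeasurable_limit (hfm _)]
    refine integral_congr_ae ?_
    filter_upwards [hW] with ω hω
    change Real.exp (-(max (c₀ * W ω) 0)) = _
    rw [max_eq_left (mul_nonneg hc₀ hω)]
  rw [← e2]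
  exact h2.congr e1

/-- Laplace transforms vanish in the limit at arguments tending to infinity, if the limit variable
has no mass at zero. -/
lemma tendsto_integral_exp_mul_zero {V : ℕ → Ω → ℝ} {W : Ω' → ℝ}
    (h : TendstoInDistribution V atTop W (fun _ => P) P') (hV : ∀ k ω, 0 ≤ V k ω)
    (hW : ∀ᵐ ω ∂P', 0 < W ω) {d : ℕ → ℝ} (hd : Tendsto d atTop atTop) :
    Tendsto (fun k => ∫ ω, Real.exp (-(d k * V k ω)) ∂P) atTop (𝓝 0) := by
  have hlim : Tendsto (fun m : ℕ => ∫ ω, Real.exp (-(m * W ω)) ∂P') atTop (𝓝 0) := by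
    have : Tendsto (fun m : ℕ => ∫ ω, Real.exp (-(m * W ω)) ∂P') atTop (𝓝 (∫ _, (0 : ℝ) ∂P')) := by
      refine tendsto_integral_of_dominated_convergence (fun _ => 1) (fun n => ?_)
        (integrable_const _) (fun n => ?_) ?_
      · exact (by fun_prop : Continuous fun x : ℝ => Real.exp (-(n * x))).comp_aestronglyMeasurable
          h.aemeasurable_limit.aestronglyMeasurable
      · filter_upwards [hW] with ω hω
        rw [Real.norm_of_nonneg (Real.exp_pos _).le, Real.exp_le_one_iff, neg_nonpos]
        positivity
      · filter_upwards [hW] with ω hω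
        exact Real.tendsto_exp_neg_atTop_nhds_zero.comp
          (tendsto_natCast_atTop_atTop.atTop_mul_const hω)
    simpa using this
  refine tendsto_order.2 ⟨fun a ha => Eventually.of_forall fun k =>
    ha.trans_le (integral_nonneg fun _ => (Real.exp_pos _).le), fun a ha => ?_⟩
  -- A fixed argument m already makes the limiting transform small, and eventually d_k ≥ m.
  obtain ⟨m, hm⟩ := (hlim.eventually (gt_mem_nhds ha)).exists
  have hm' := tendsto_integral_exp_mul_of_tendstoInDistribution h hV (hW.mono fun _ h => h.le)
    (tendsto_const_nhds (x := (m : ℝ))) (fun _ => m.cast_nonneg)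
  filter_upwards [hm'.eventually (gt_mem_nhds hm), hd.eventually_ge_atTop (m : ℝ)] with k hk hdk
  refine lt_of_le_of_lt (integral_mono_of_nonneg (ae_of_all _ fun _ => (Real.exp_pos _).le) ?_
    (ae_of_all _ fun ω => ?_)) hk
  · refine Integrable.of_bound ((by fun_prop : Continuous fun x : ℝ =>
      Real.exp (-(m * x))).comp_aestronglyMeasurable
        (h.forall_aemeasurable k).aestronglyMeasurable) 1 (ae_of_all _ fun ω => ?_)
    rw [Real.norm_of_nonneg (Real.exp_pos _).le, Real.exp_le_one_iff, neg_nonpos]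
    exact mul_nonneg m.cast_nonneg (hV k ω)
  · exact Real.exp_le_exp.2 (neg_le_neg (mul_le_mul_of_nonneg_right hdk (hV k ω)))

lemma exists_lt_measureReal_lt {X : Ω → ℝ} (hX : Measurable X) {q : ℝ} (hq : q < 1) :
    ∃ x, q < P.real {ω | X ω < x} := by
  have := Measure.isProbabilityMeasure_map (μ := P) hX.aemeasurable
  obtain ⟨x, hx⟩ := ((tendsto_cdf_atTop (P.map X)).eventually (lt_mem_nhds hq)).exists
  refine ⟨x + 1, hx.trans_le ?_⟩
  rw [cdf_eq_real, map_measureReal_apply hX measurableSet_Iic]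
  exact measureReal_mono fun ω hω => lt_of_le_of_lt (mem_Iic.1 hω) (lt_add_one x)

end

/-! ### The limit theorem -/

theorem theorem6
    {Ω : Type*} [MeasurableSpace Ω] (P : Measure Ω) [IsProbabilityMeasure P]
    {Ω' : Type*} [MeasurableSpace Ω'] (P' : Measure Ω') [IsProbabilityMeasure P']
    (δ : ℝ) (hδ : δ ∈ Ioo (0 : ℝ) 1)
    -- the sample: i.i.d. with distribution function `F`
    (X : ℕ → Ω → ℝ) (hX : ∀ i, Measurable (X i)) (hXind : iIndepFun X P)
    (F : ℝ → ℝ) (hF : ∀ i x, F x = P.real {ω | X i ω < x})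
    -- the sample sizes `N k = Q (U k)`, with `Q` a unit Poisson process independent of `U k`
    (Q : ℝ≥0 → Ω → ℕ) (hQ : IsUnitPoissonProcess Q P)
    (U : ℕ → Ω → ℝ≥0) (hU : ∀ k, Measurable (U k))
    (hUQ : ∀ k, IndepFun (U k) (fun ω t => Q t ω) P)
    (N : ℕ → Ω → ℕ) (hN : ∀ k ω, N k ω = Q (U k ω) ω)
    (hNX : ∀ k, IndepFun (N k) (fun ω i => X i ω) P)
    -- condition (i)
    (δ' : ℝ) (hδ' : δ' ∈ Ioc δ 1) (hFδ' : MinDomainWeibull F δ')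
    -- condition (ii)
    (d : ℕ → ℝ) (hd_pos : ∀ k, 0 < d k) (hd : Tendsto d atTop atTop)
    (S K : Ω' → ℝ) (hSm : Measurable S) (hKm : Measurable K)
    (hS : IsStrictlyStable δ' 1 (P'.map S)) (hK : P'.map K = kMeasure (δ / δ'))
    (hSK : IndepFun S K P')
    (hlim : TendstoInDistribution (fun k ω => (U k ω : ℝ) / d k) atTop
      (fun ω => S ω ^ (-δ') * K ω ^ (δ' / δ)) (fun _ => P) P') :
    ∃ ν : ProbabilityMeasure ℝ, IsMittagLeffler δ (ν : Measure ℝ) ∧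
      ∃ a b : ℕ → ℝ,
        (∀ k, 0 < b k) ∧
        (∀ k, a k = lext F) ∧
        (∀ k, 1 < d k → BddAbove {x | F x ≤ (d k)⁻¹} ∧
          b k = sSup {x | F x ≤ (d k)⁻¹} - lext F) ∧
        ∀ c : ℝ, TendstoInDistribution
          (fun k ω => (sampleMin c (fun j => X j ω) (N k ω) - a k) / b k)
          atTop (fun x : ℝ => x) (fun _ => P) (ν : Measure ℝ) := by

  obtain ⟨hδ0, -⟩ := hδ
  obtain ⟨hδδ', hδ'1⟩ := hδ'
  have hδ'0 : 0 < δ' := hδ0.trans hδδ'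
  have hSpos : ∀ᵐ ω ∂P', 0 < S ω := ae_of_ae_map hSm.aemeasurable (hS.ae_pos hδ'0 hδ'1)
  have hKpos : ∀ᵐ ω ∂P', 0 < K ω := ae_of_ae_map hKm.aemeasurable (hK ▸ kMeasure_ae_pos _)
  have hWpos : ∀ᵐ ω ∂P', 0 < S ω ^ (-δ') * K ω ^ (δ' / δ) := by
    filter_upwards [hSpos, hKpos] with ω hs hk
    positivity
  have hML := isMittagLeffler_mittagLefflerMixture hδ0 hδδ' hδ'1 hSm hKm hS hK hSK
  have := hML.isProbabilityMeasure
  have hmono : Monotone F := fun x y hxy => by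
    rw [hF 0, hF 0]
    exact measureReal_mono fun ω hω => lt_of_lt_of_le hω hxy
  have hF0 : ∀ x, 0 ≤ F x := fun x => by rw [hF 0]; exact measureReal_nonneg
  have hF1 : ∀ x, F x ≤ 1 := fun x => by rw [hF 0]; exact measureReal_le_one
  have hFlim : ∀ q < 1, ∃ x, q < F x := fun q hq => by
    simp only [hF 0]
    exact exists_lt_measureReal_lt (hX 0) hq
  have hbpos := hFδ'.minScale_pos hδ'0 hmono hF0 hFlim
  refine ⟨⟨_, hML.isProbabilityMeasure⟩, hML, fun _ => lext F, fun k => minScale F (d k),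
    fun k => hbpos _, fun _ => rfl, fun k hk => ⟨bddAbove_setOf_le hmono
      (hFlim _ (inv_lt_one_of_one_lt₀ hk)), by simp only [minScale, if_pos hk]⟩, fun c => ?_⟩
  have hNm : ∀ k, Measurable (N k) := fun k => by
    rw [funext (hN k)]
    exact hQ.measurable_comp (hU k)
  have hXm : Measurable (fun ω i => X i ω) := measurable_pi_lambda _ hX
  have hmin : ∀ k, Measurable fun ω => sampleMin c (fun j => X j ω) (N k ω) := fun k =>
    (measurable_sampleMin c).comp ((hNm k).prodMk hXm)
  have hYm : ∀ k, Measurable fun ω =>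
      (sampleMin c (fun j => X j ω) (N k ω) - lext F) / minScale F (d k) := fun k =>
    ((hmin k).sub_const _).div_const _
  have hVnn : ∀ k ω, 0 ≤ (U k ω : ℝ) / d k := fun k ω =>
    div_nonneg (U k ω).2 (hd_pos k).le
  have hpgf : ∀ k z, z ∈ Icc (0 : ℝ) 1 → ∫ ω, z ^ N k ω ∂P =
      ∫ ω, Real.exp (-(d k * (1 - z) * ((U k ω : ℝ) / d k))) ∂P := by
    intro k z hz
    simp only [hN]
    rw [hQ.integral_pow_comp (hU k) (hUQ k) hz]
    congr 1
    ext ω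
    congr 1
    have := (hd_pos k).ne'
    field_simp
  -- The generating function at z = 0 is 𝔼 exp(-d_k · U_k/d_k), which vanishes in the limit because
  -- W > 0 almost surely.
  have hempty : Tendsto (fun k => ∫ ω, (0 : ℝ) ^ N k ω ∂P) atTop (𝓝 0) := by
    refine (tendsto_integral_exp_mul_zero hlim hVnn hWpos hd).congr
      fun k => ?_
    rw [hpgf k 0 (by simp), sub_zero, mul_one]
  have hmain : ∀ x : ℝ, Tendsto
      (fun k => ∫ ω, (1 - F (lext F + minScale F (d k) * x)) ^ N k ω ∂P) atTop
      (𝓝 ((mittagLefflerMixture P' δ δ' S K).real (Ici x))) := by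
    intro x
    rcases le_or_gt x 0 with hx | hx
    · rw [measureReal_mittagLefflerMixture_Ici_of_nonpos hSm hKm hSpos hKpos hx]
      refine tendsto_const_nhds.congr fun k => ?_
      rw [hFδ'.eq_zero_of_le hδ'0 hmono hF0
        (by linarith [mul_nonpos_of_nonneg_of_nonpos (hbpos (d k)).le hx])]
      simp
    · rw [measureReal_mittagLefflerMixture_Ici hδ0 hδ'0 hSm hKm hSpos hKpos hx.le]
      refine (tendsto_integral_exp_mul_of_tendstoInDistribution hlim hVnn
        (hWpos.mono fun _ h => h.le) ((hFδ'.tendsto_mul hδ'0 hmono hF0 hFlim hx).comp hd)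
        (fun k => mul_nonneg (hd_pos k).le (hF0 _))).congr fun k => ?_
      rw [hpgf k _ ⟨by linarith [hF1 (lext F + minScale F (d k) * x)],
        by linarith [hF0 (lext F + minScale F (d k) * x)]⟩, sub_sub_cancel]
      rfl
  change TendstoInDistribution _ _ _ _ (mittagLefflerMixture P' δ δ' S K)
  refine ⟨fun k => (hYm k).aemeasurable, aemeasurable_id, ?_⟩
  refine tendsto_probabilityMeasure_of_tendsto_Ici fun x => ?_
  simp only [ProbabilityMeasure.coe_mk, Measure.map_id']
  have hset : ∀ k, (P.map fun ω => (sampleMin c (fun j => X j ω) (N k ω) - lext F) /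
      minScale F (d k)).real (Ici x) = P.real {ω | lext F + minScale F (d k) * x ≤
        sampleMin c (fun j => X j ω) (N k ω)} := by
    intro k
    rw [map_measureReal_apply (hYm k) measurableSet_Ici]
    congr 1
    ext ω
    simp only [mem_preimage, mem_Ici, mem_ofPred_eq]
    rw [le_div_iff₀ (hbpos _), le_sub_iff_add_le, add_comm, mul_comm]
  simp only [hset]
  -- Uniformly in the threshold, the error is at most the probability of an empty sample.
  have hdiff : Tendsto (fun k => P.real {ω | lext F + minScale F (d k) * x ≤
      sampleMin c (fun j => X j ω) (N k ω)} -
        ∫ ω, (1 - F (lext F + minScale F (d k) * x)) ^ N k ω ∂P) atTop (𝓝 0) :=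
    squeeze_zero_norm (fun k => abs_measureReal_le_sampleMin_sub_le hX hXind hF (hNm k) (hNX k)
      c _) hempty
  simpa using hdiff.add (hmain x)
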